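/- **Theorem (permutation graphs admit $\mathrm{FP{+}C}$-definable canonization).** Graphs are finite, simple, undirected and have a non-empty vertex set. $\mathrm{FP{+}C}$ is inflationary fixed-point logic with counting (two-sorted: structure variables range over the universe $U(A)$ and number variables over $[0,|U(A)|]$), and $\mathrm{FP}$ is its fragment without number variables. A *realizer* of a graph $G=(V,E)$ is a pair $(<_1,<_2)$ of strict linear orders on $V$ such that $u,v\in V$ are adjacent if and only if they occur in different order in $<_1$ and $<_2$; $G$ is a *permutation graph* if it has a realizer. A non-empty set $M\subseteq V$ is a *module* of $G$ if every vertex outside $M$ is adjacent to all or to none of the vertices of $M$, and $G$ is *prime* if its only modules are $V$ and the singletons. 1. The class of permutation graphs admits $\mathrm{FP{+}C}$-definable canonization: there is a single parameter-free $\mathrm{FP{+}C}[\{E\},\{E,\leq\}]$-transduction $\Theta$ such that for every permutation graph $G$, $G$ is in the domain of $\Theta$, the relation $\leq$ of $\Theta[G]$ is a linear order on its universe, and the $\{E\}$-reduct of $\Theta[G]$ is isomorphic to $G$. 2. For a graph $G=(V,E)$ and $w\in V$ let $\vartriangleleft^w_{1,0}=\{(w,v)\mid v\in V,\ v\neq w\}$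 and $\vartriangleleft^w_{2,0}=\emptyset$. For $k\ge 0$ and $i\in\{1,2\}$ let $\vartriangleleft^w_{i,k+1}$ be the transitive closure of $$\vartriangleleft^w_{i,k}\ \cup\ \{(v,u)\mid u\vartriangleleft^w_{3-i,k}v,\ \{u,v\}\in E\}\ \cup\ \{(u,v)\mid u\vartriangleleft^w_{3-i,k}v,\ \{u,v\}\notin E\},$$ and let $\vartriangleleft^w_i=\bigcup_{k\ge 0}\vartriangleleft^w_{i,k}$. There are $\mathrm{FP}$-formulas $\varphi_1(x,y,y')$ and $\varphi_2(x,y,y')$ such that for every prime permutation graph $G=(V,E)$: * for all $w,v,v'\in V$ and $i\in\{1,2\}$, $G\models\varphi_i[w,v,v']$ if and only if $v\vartriangleleft_i^w v'$; * for every realizer $(<_1,<_2)$ of $G$, if $w$ is the first element of $<_1$, then $\vartriangleleft_1^w\,=\,<_1$ and $\vartriangleleft_2^w\,=\,<_2$. Moreover, the $\mathrm{FP}$-formula $\varphi(x,y,y'):=\varphi_1(x,y,y')\lor y=y'$ defines orders on the class of prime permutation graphs: for every prime permutation graph $G$ there is $w\in V$ such that $\{(v,v')\mid G\models\varphi[w,v,v']\}$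 is a linear order on $V$. -/

import Mathlib

namespace FPC

/-! ### Syntax of fixed-point logic with counting

A formula lives in a context consisting of the types `α` and `β` of free structure and number
variables, and the list of types of the free relational variables. A tuple of `k` structure
variables and `l` number variables is written with its structure part first; its type is `(k, l)`. -/

/-- The relational variables of type `(k, l)` in a context `Δ` of relational variables. -/
inductive RVar : List (ℕ × ℕ) → ℕ → ℕ → Type
  | here {k l : ℕ} {Δ : List (ℕ × ℕ)} : RVar ((k, l) :: Δ) k l
  | there {k l k' l' : ℕ} {Δ : List (ℕ × ℕ)} (X : RVar Δ k l) : RVar ((k', l') :: Δ) k l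

/-- `FP+C[L]`-formulas with free structure variables in `α`, free number variables in `β`
and free relational variables in `Δ`. -/
inductive Formula (L : FirstOrder.Language.{0, 0}) : Type → Type → List (ℕ × ℕ) → Type 1
  | falsum {α β : Type} {Δ : List (ℕ × ℕ)} : Formula L α β Δ
  | eq {α β : Type} {Δ : List (ℕ × ℕ)} (x y : α) : Formula L α β Δ
  | rel {α β : Type} {Δ : List (ℕ × ℕ)} {r : ℕ} (R : L.Relations r) (x : Fin r → α) :
      Formula L α β Δ
  | neg {α β : Type} {Δ : List (ℕ × ℕ)} (φ : Formula L α β Δ) : Formula L α β Δ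
  | and {α β : Type} {Δ : List (ℕ × ℕ)} (φ ψ : Formula L α β Δ) : Formula L α β Δ
  /-- existential quantification over a structure variable -/
  | ex {α β : Type} {Δ : List (ℕ × ℕ)} (φ : Formula L (Option α) β Δ) : Formula L α β Δ
  /-- existential quantification over a number variable -/
  | exNum {α β : Type} {Δ : List (ℕ × ℕ)} (φ : Formula L α (Option β) Δ) : Formula L α β Δ
  /-- `p ≤ q` for number variables -/
  | le {α β : Type} {Δ : List (ℕ × ℕ)} (p q : β) : Formula L α β Δ
  /-- `# u ψ = p`, where `u` consists of `k` structure variables and `l` number variables -/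
  | count {α β : Type} {Δ : List (ℕ × ℕ)} {k l j : ℕ} (ψ : Formula L (α ⊕ Fin k) (β ⊕ Fin l) Δ)
      (p : Fin j → β) : Formula L α β Δ
  /-- `X (x, p)` for a relational variable `X` -/
  | rvar {α β : Type} {Δ : List (ℕ × ℕ)} {k l : ℕ} (X : RVar Δ k l) (x : Fin k → α)
      (p : Fin l → β) : Formula L α β Δ
  /-- `[ifp_{X, u} ψ] (x, p)`, where `X` and `u` are of type `(k, l)` -/
  | ifp {α β : Type} {Δ : List (ℕ × ℕ)} {k l : ℕ}
      (ψ : Formula L (α ⊕ Fin k) (β ⊕ Fin l) ((k, l) :: Δ)) (x : Fin k → α) (p : Fin l → β) :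
      Formula L α β Δ

/-- Disjunction. -/
def Formula.or {L : FirstOrder.Language.{0, 0}} {α β : Type} {Δ : List (ℕ × ℕ)}
    (φ ψ : Formula L α β Δ) : Formula L α β Δ :=
  .neg (.and (.neg φ) (.neg ψ))

/-- The formulas of fixed-point logic `FP` (without counting): number variables do not occur. -/
def Formula.IsFP {L : FirstOrder.Language.{0, 0}} :
    {α β : Type} → {Δ : List (ℕ × ℕ)} → Formula L α β Δ → Prop
  | _, _, _, .falsum => True
  | _, _, _, .eq _ _ => True
  | _, _, _, .rel _ _ => True
  | _, _, _, .neg φ => φ.IsFP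
  | _, _, _, .and φ ψ => φ.IsFP ∧ ψ.IsFP
  | _, _, _, .ex φ => φ.IsFP
  | _, _, _, .exNum _ => False
  | _, _, _, .le _ _ => False
  | _, _, _, .count _ _ => False
  | _, _, _, .rvar (l := l) _ _ _ => l = 0
  | _, _, _, .ifp (l := l) ψ _ _ => l = 0 ∧ ψ.IsFP

/-! ### Semantics -/

/-- The number sort `[0, |U|]` of a structure with universe `U`. -/
abbrev Num (U : Type) : Type := Fin (Nat.card U + 1)

/-- Values of a tuple of `k` structure variables and `l` number variables. -/
abbrev Tup (U : Type) (k l : ℕ) : Type := (Fin k → U) × (Fin l → Num U)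

/-- The number `∑ nᵢ (|U| + 1) ^ i` (`i = 0, …, j - 1`) represented by a tuple over the number
sort. -/
noncomputable def numVal {U : Type} {j : ℕ} (n : Fin j → Num U) : ℕ :=
  ∑ i : Fin j, (n i : ℕ) * (Nat.card U + 1) ^ (i : ℕ)

/-- Assignments of relations to the relational variables in `Δ`. -/
abbrev RelAssignment (U : Type) (Δ : List (ℕ × ℕ)) : Type :=
  ∀ k l : ℕ, RVar Δ k l → Set (Tup U k l)

/-- The assignment of the empty context. -/
def RelAssignment.nil {U : Type} : RelAssignment U []
  | _, _, X => nomatch X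

/-- Extend an assignment by a relation for a new relational variable. -/
def RelAssignment.cons {U : Type} {Δ : List (ℕ × ℕ)} {k l : ℕ} (R : Set (Tup U k l))
    (ρ : RelAssignment U Δ) : RelAssignment U ((k, l) :: Δ)
  | _, _, .here => R
  | _, _, .there X => ρ _ _ X

/-- Extend an assignment by a value for a new variable. -/
def extend {α D : Type} (d : D) (x : α → D) : Option α → D
  | none => d
  | some a => x a

/-- The inflationary fixed point of `F`: the union of the stages `R₀ = ∅`,
`Rᵢ₊₁ = Rᵢ ∪ F Rᵢ`. For finite `T` this is the stage at which the sequence becomes stationary. -/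
def inflationaryFixedPoint {T : Type} (F : Set T → Set T) : Set T :=
  ⋃ i : ℕ, (fun R => R ∪ F R)^[i] ∅

/-- Satisfaction of a formula in the structure `S` under the assignments `x` of the structure
variables, `n` of the number variables and `ρ` of the relational variables. -/
def Formula.Sat {L : FirstOrder.Language.{0, 0}} {U : Type} (S : L.Structure U) :
    {α β : Type} → {Δ : List (ℕ × ℕ)} → Formula L α β Δ →
      (α → U) → (β → Num U) → RelAssignment U Δ → Prop
  | _, _, _, .falsum, _, _, _ => False
  | _, _, _, .eq a b, x, _, _ => x a = x b
  | _, _, _, .rel R a, x, _, _ => S.RelMap R (fun i => x (a i))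
  | _, _, _, .neg φ, x, n, ρ => ¬ φ.Sat S x n ρ
  | _, _, _, .and φ ψ, x, n, ρ => φ.Sat S x n ρ ∧ ψ.Sat S x n ρ
  | _, _, _, .ex φ, x, n, ρ => ∃ u : U, φ.Sat S (extend u x) n ρ
  | _, _, _, .exNum φ, x, n, ρ => ∃ m : Num U, φ.Sat S x (extend m n) ρ
  | _, _, _, .le p q, _, n, _ => n p ≤ n q
  | _, _, _, .count (k := k) (l := l) ψ p, x, n, ρ =>
      Set.ncard {t : Tup U k l | ψ.Sat S (Sum.elim x t.1) (Sum.elim n t.2) ρ} =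
        numVal (fun i => n (p i))
  | _, _, _, .rvar X a p, x, n, ρ => ((fun i => x (a i)), (fun i => n (p i))) ∈ ρ _ _ X
  | _, _, _, .ifp (k := k) (l := l) ψ a p, x, n, ρ =>
      ((fun i => x (a i)), (fun i => n (p i))) ∈
        inflationaryFixedPoint (fun R : Set (Tup U k l) =>
          {t | ψ.Sat S (Sum.elim x t.1) (Sum.elim n t.2) (RelAssignment.cons R ρ)})

/-! ### Transductions -/

/-- An `FP+C[L₁, L₂]`-transduction (without parameters), whose tuple of domain variables consists of
`k` structure variables and `l` number variables. -/
structure Transduction (L₁ L₂ : FirstOrder.Language.{0, 0}) where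
  k : ℕ
  l : ℕ
  /-- the formula `θ_dom` -/
  dom : Formula L₁ Empty Empty []
  /-- the formula `θ_U(u)` -/
  univ : Formula L₁ (Fin k) (Fin l) []
  /-- the formula `θ_≈(u, u')` -/
  equiv : Formula L₁ (Fin k ⊕ Fin k) (Fin l ⊕ Fin l) []
  /-- the formulas `θ_R(u₁, …, uᵣ)` -/
  rel : {r : ℕ} → L₂.Relations r → Formula L₁ (Fin r × Fin k) (Fin r × Fin l) []

namespace Transduction

variable {L₁ L₂ : FirstOrder.Language.{0, 0}}

/-- Membership of a tuple in `θ_U[A; u]`. -/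
def Univ (Θ : Transduction L₁ L₂) {U : Type} (S : L₁.Structure U) (t : Tup U Θ.k Θ.l) : Prop :=
  Θ.univ.Sat S t.1 t.2 RelAssignment.nil

/-- Membership of a pair of tuples in `θ_≈[A; u, u']`. -/
def Equiv (Θ : Transduction L₁ L₂) {U : Type} (S : L₁.Structure U) (t t' : Tup U Θ.k Θ.l) : Prop :=
  Θ.equiv.Sat S (Sum.elim t.1 t'.1) (Sum.elim t.2 t'.2) RelAssignment.nil

/-- Membership of a tuple of tuples in `θ_R[A; u₁, …, uᵣ]`. -/
def Rel (Θ : Transduction L₁ L₂) {U : Type} (S : L₁.Structure U) {r : ℕ} (R : L₂.Relations r)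
    (t : Fin r → Tup U Θ.k Θ.l) : Prop :=
  (Θ.rel R).Sat S (fun i => (t i.1).1 i.2) (fun i => (t i.1).2 i.2) RelAssignment.nil

/-- The structure `S` is in the domain of `Θ`. -/
def InDom (Θ : Transduction L₁ L₂) {U : Type} (S : L₁.Structure U) : Prop :=
  Θ.dom.Sat S Empty.elim Empty.elim RelAssignment.nil ∧ ∃ t, Θ.Univ S t

/-- The universe of `Θ[S]`: the classes of the elements of `θ_U[S; u]` modulo the equivalence
relation generated by `θ_≈[S; u, u']` on all tuples. -/
def Carrier (Θ : Transduction L₁ L₂) {U : Type} (S : L₁.Structure U) : Type :=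
  {q : Quot (Θ.Equiv S) // ∃ t, Θ.Univ S t ∧ Quot.mk (Θ.Equiv S) t = q}

/-- The structure `Θ[S]`. -/
@[reducible]
def output [L₂.IsRelational] (Θ : Transduction L₁ L₂) {U : Type} (S : L₁.Structure U) :
    L₂.Structure (Θ.Carrier S) where
  funMap := fun f => isEmptyElim f
  RelMap := fun {r} R q => ∃ t : Fin r → Tup U Θ.k Θ.l,
    Θ.Rel S R t ∧ (∀ i, Θ.Univ S (t i)) ∧ ∀ i, Quot.mk (Θ.Equiv S) (t i) = (q i).1

end Transduction

/-! ### Canonization -/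

/-- The vocabulary `τ ∪ {≤}`. -/
abbrev WithOrder (L : FirstOrder.Language.{0, 0}) : FirstOrder.Language.{0, 0} :=
  L.sum FirstOrder.Language.order

/-- The structure `B` over `τ ∪ {≤}` is an ordered copy of the `τ`-structure `A`. -/
def IsOrderedCopy {L : FirstOrder.Language.{0, 0}} {U W : Type} (A : L.Structure U)
    (B : (WithOrder L).Structure W) : Prop :=
  IsLinearOrder W (fun a b =>
    B.RelMap (FirstOrder.Language.leSymb : (WithOrder L).Relations 2) ![a, b]) ∧
    (letI : L.Structure W :=
      FirstOrder.Language.LHom.reduct (L' := WithOrder L) FirstOrder.Language.LHom.sumInl W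
     Nonempty (FirstOrder.Language.Equiv L W U))

/-- `Θ` canonizes the structure `S`. -/
def Transduction.Canonizes {L : FirstOrder.Language.{0, 0}} [L.IsRelational]
    (Θ : Transduction L (WithOrder L)) {U : Type} (S : L.Structure U) : Prop :=
  Θ.InDom S ∧ IsOrderedCopy S (Θ.output S)

/-- A class of structures; only its members with a finite non-empty universe are relevant. -/
abbrev StructureClass (L : FirstOrder.Language.{0, 0}) : Type 1 :=
  ∀ U : Type, L.Structure U → Prop

/-- The class `C` admits `FP+C`-definable canonization: there is an `FP+C`-canonization of `C`
without parameters. -/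
def AdmitsCanonization {L : FirstOrder.Language.{0, 0}} [L.IsRelational]
    (C : StructureClass L) : Prop :=
  ∃ Θ : Transduction L (WithOrder L),
    ∀ (U : Type) [Finite U] [Nonempty U] (S : L.Structure U), C U S → Θ.Canonizes S

/-! ### Graph classes -/

/-- A class of graphs; only its members with a finite non-empty vertex set are relevant. -/
abbrev GraphClass : Type 1 := ∀ V : Type, SimpleGraph V → Prop

/-- The graphs of a class as structures over the vocabulary of graphs. -/
def GraphClass.toStructureClass (C : GraphClass) : StructureClass FirstOrder.Language.graph :=
  fun V S => ∃ G : SimpleGraph V, C V G ∧ S = G.structure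

/-- `φ(x, y, y')` defines orders on the class `C`; the tuple `x` of parameter variables consists of
`k` structure variables and `l` number variables. -/
def Formula.DefinesOrders {k l : ℕ}
    (φ : Formula FirstOrder.Language.graph (Fin k ⊕ Fin 2) (Fin l) [])
    (C : GraphClass) : Prop :=
  ∀ (V : Type) [Finite V] [Nonempty V] (G : SimpleGraph V), C V G →
    ∃ v : Tup V k l, IsLinearOrder V
      (fun y y' => φ.Sat G.structure (Sum.elim v.1 ![y, y']) v.2 RelAssignment.nil)

/-- `M` is a module of `G`. -/
def IsModule {V : Type} (G : SimpleGraph V) (M : Set V) : Prop :=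
  M.Nonempty ∧ ∀ v ∉ M, ∀ w ∈ M, ∀ w' ∈ M, (G.Adj v w ↔ G.Adj v w')

/-- `G` is prime: all its modules are trivial. -/
def IsPrime {V : Type} (G : SimpleGraph V) : Prop :=
  ∀ M : Set V, IsModule G M → M = Set.univ ∨ ∃ v, M = {v}

/-- `(lt₁, lt₂)` is a realizer of `G`. -/
def IsRealizer {V : Type} (G : SimpleGraph V) (lt₁ lt₂ : V → V → Prop) : Prop :=
  IsStrictTotalOrder V lt₁ ∧ IsStrictTotalOrder V lt₂ ∧
    ∀ u v, G.Adj u v ↔ (lt₁ u v ∧ lt₂ v u) ∨ (lt₁ v u ∧ lt₂ u v)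

/-- The class of permutation graphs. -/
def permutationGraphs : GraphClass :=
  fun _ G => ∃ lt₁ lt₂, IsRealizer G lt₁ lt₂

/-- The class of prime permutation graphs. -/
def primePermutationGraphs : GraphClass :=
  fun V G => IsPrime G ∧ permutationGraphs V G

/-! ### Reconstructing a realizer from a start vertex -/

/-- One component of the closure of a pair of relations under the edge relation: `r` is the
component itself and `s` is the other component. -/
def edgeClosure {V : Type} (G : SimpleGraph V) (r s : V → V → Prop) (u v : V) : Prop :=
  r u v ∨ (s v u ∧ G.Adj u v) ∨ (s u v ∧ ¬ G.Adj u v)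

/-- The stages of the reconstruction from the start vertex `w`: close under the edge relation and
then take the transitive closure. -/
def stage {V : Type} (G : SimpleGraph V) (w : V) : ℕ → (V → V → Prop) × (V → V → Prop)
  | 0 => (fun u v => u = w ∧ v ≠ w, fun _ _ => False)
  | k + 1 =>
      (Relation.TransGen (edgeClosure G (stage G w k).1 (stage G w k).2),
        Relation.TransGen (edgeClosure G (stage G w k).2 (stage G w k).1))

/-- The first relation reconstructed from `w`: the union of the (increasing) stages. -/
def reconstruct₁ {V : Type} (G : SimpleGraph V) (w u v : V) : Prop :=
  ∃ k, (stage G w k).1 u v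

/-- The second relation reconstructed from `w`. -/
def reconstruct₂ {V : Type} (G : SimpleGraph V) (w u v : V) : Prop :=
  ∃ k, (stage G w k).2 u v

end FPC

/-! A permutation graph is canonized along a modular decomposition. Starting from the whole vertex
set, a class is split into its connected components if it is disconnected, otherwise into its
co-components if its complement is disconnected, and otherwise into its maximal proper modules
(`split`). The parts are modules of the class (`split_adj_iff`), and every class with at least two
elements is properly split, so after |V| levels only singletons remain (`level_card_iff`). The
quotient of a class by its parts is edgeless, complete or prime (`split_trichotomy`).

In a prime quotient a realizer is determined by its first element. That element precedes everything
in the first order, and adjacency tells how a pair ordered by one relation is ordered by the other.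
Closing under this rule and transitivity produces only pairs that hold in the realizer
(`RecData.sound`). If two elements stayed incomparable, their component under incomparability would
be a proper module, against primality (`RecData.total`). Applied to a prime graph itself, this gives
the second claim (`reconstruct_eq`).

Canonical codes are built from the singletons upward. The parts of an edgeless or complete quotient
are sorted by their codes; ties are harmless because tied parts are interchangeable. The parts of a
prime quotient are sorted by the reconstructed order, and the least code over all usable start
vertices is kept. Concatenation along such a preorder yields a code of the class without ordering
the tied parts (`IsGoodOrder.isCodeOf_concat`), and induction over the levels gives
`isCodeOf_canonCode`.

Reachability, module closure and reconstruction are least fixed points of monotone operators, hence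
definable in FP (`DefinableTuple.lfp`). The recursion through the levels is an inflationary fixed
point with a number as stage counter (`definable_numRec`), and positions are computed by counting.
The transduction has the numbers below |V| as its universe and reads the edges off the code of the
whole graph. -/

namespace FPC

/-! ### Splitting the classes of an equivalence relation into modules -/

section Splitting

variable {V : Type} {G : SimpleGraph V} {r E : V → V → Prop}

/-- Reachability along `E`-steps inside the classes of `r`. -/
def Linked (r E : V → V → Prop) : V → V → Prop :=
  Relation.ReflTransGen fun x y => r x y ∧ E x y

/-- The `r`-class of `u` is not connected with respect to `E`. -/
def Disconnected (r E : V → V → Prop) (u : V) : Prop :=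
  ∃ z, r u z ∧ ¬ Linked r E u z

/-- Non-adjacency. -/
def NonAdj (G : SimpleGraph V) (x y : V) : Prop := ¬ G.Adj x y

/-- The least module of the `r`-class of `u` containing `u` and `v`. -/
inductive ModuleClosure (G : SimpleGraph V) (r : V → V → Prop) (u v : V) : V → Prop
  | left : ModuleClosure G r u v u
  | right : ModuleClosure G r u v v
  | step {x y z : V} (h : r u z) (hx : ModuleClosure G r u v x) (hy : ModuleClosure G r u v y)
      (hzx : G.Adj z x) (hzy : ¬ G.Adj z y) : ModuleClosure G r u v z

/-- Split every class of `r` into its components, its co-components, or its maximal proper modules,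
whichever applies first. -/
def split (G : SimpleGraph V) (r : V → V → Prop) (u v : V) : Prop :=
  r u v ∧ ((Disconnected r G.Adj u ∧ Linked r G.Adj u v) ∨
    (¬ Disconnected r G.Adj u ∧ Disconnected r (NonAdj G) u ∧ Linked r (NonAdj G) u v) ∨
    (¬ Disconnected r G.Adj u ∧ ¬ Disconnected r (NonAdj G) u ∧
      (u = v ∨ ∃ z, r u z ∧ ¬ ModuleClosure G r u v z)))

/-- `X` is a possibly empty module of the subgraph induced by `M`. -/
def IsModuleIn (G : SimpleGraph V) (M X : Set V) : Prop :=
  X ⊆ M ∧ ∀ z ∈ M, z ∉ X → ∀ x ∈ X, ∀ y ∈ X, G.Adj z x ↔ G.Adj z y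

lemma nonAdj_symm {x y : V} (h : NonAdj G x y) : NonAdj G y x := fun h' => h h'.symm

lemma Linked.rel (hr : Equivalence r) {x y : V} (h : Linked r E x y) : r x y := by
  induction h with
  | refl => exact hr.refl _
  | tail _ h ih => exact hr.trans ih h.1

lemma Linked.symm (hr : Equivalence r) (hE : ∀ {x y}, E x y → E y x) {x y : V}
    (h : Linked r E x y) : Linked r E y x := by
  induction h with
  | refl => exact .refl
  | tail _ h ih => exact .head ⟨hr.symm h.1, hE h.2⟩ ih

lemma Linked.invariant {P : V → Prop} (hP : ∀ x y, P x → r x y → E x y → P y) {x y : V}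
    (h : Linked r E x y) (hx : P x) : P y := by
  induction h with
  | refl => exact hx
  | tail _ h ih => exact hP _ _ ih h.1 h.2

lemma linked_of_not_disconnected (hr : Equivalence r) (hE : ∀ {x y}, E x y → E y x) {u x y : V}
    (h : ¬ Disconnected r E u) (hx : r u x) (hy : r u y) : Linked r E x y := by
  simp only [Disconnected, not_exists, not_and, not_not] at h
  exact ((h x hx).symm hr hE).trans (h y hy)

lemma disconnected_congr (hr : Equivalence r) (hE : ∀ {x y}, E x y → E y x) {u v : V}
    (h : r u v) : Disconnected r E u ↔ Disconnected r E v := by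
  constructor
  · intro hu
    by_contra hv
    obtain ⟨z, hz, hz'⟩ := hu
    exact hz' (linked_of_not_disconnected hr hE hv (hr.symm h) (hr.trans (hr.symm h) hz))
  · intro hv
    by_contra hu
    obtain ⟨z, hz, hz'⟩ := hv
    exact hz' (linked_of_not_disconnected hr hE hu h (hr.trans h hz))

/-- A vertex of the class that distinguishes two members of the closure has been added by `step`. -/
lemma isModuleIn_moduleClosure (hr : Equivalence r) {u v : V} (h : r u v) :
    IsModuleIn G {x | r u x} {x | ModuleClosure G r u v x} := by
  constructor
  · intro x hx
    cases hx with
    | left => exact hr.refl _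
    | right => exact h
    | step h => exact h
  · intro z hz hzX x hx y hy
    by_contra hne
    by_cases hzx : G.Adj z x
    · exact hzX (ModuleClosure.step hz hx hy hzx fun hzy => hne (by simp [hzx, hzy]))
    · by_cases hzy : G.Adj z y
      · exact hzX (ModuleClosure.step hz hy hx hzy hzx)
      · exact hne (by simp [hzx, hzy])

lemma moduleClosure_subset {u v : V} {X : Set V} (hX : IsModuleIn G {x | r u x} X) (hu : u ∈ X)
    (hv : v ∈ X) {z : V} (hz : ModuleClosure G r u v z) : z ∈ X := by
  induction hz with
  | left => exact hu
  | right => exact hv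
  | step h _ _ hzx hzy hx hy =>
    by_contra hzX
    exact hzy ((hX.2 _ h hzX _ hx _ hy).1 hzx)

/-! ### Unions of modules in connected and co-connected classes -/

/-- Two overlapping proper modules of a connected and co-connected class do not cover it. -/
lemma union_ne_of_isModuleIn (hr : Equivalence r) {u v : V} {X Y : Set V}
    (h₁ : ∀ x y, r u x → r u y → Linked r G.Adj x y)
    (h₂ : ∀ x y, r u x → r u y → Linked r (NonAdj G) x y)
    (hX : IsModuleIn G {x | r u x} X) (hY : IsModuleIn G {x | r u x} Y) (hvX : v ∈ X)
    (hXu : X ≠ {x | r u x}) (hYu : Y ≠ {x | r u x}) : X ∪ Y ≠ {x | r u x} := by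
  intro hXY
  obtain ⟨b, hb, hbX⟩ : ∃ b, r u b ∧ b ∉ X := by
    by_contra! h
    exact hXu (hX.1.antisymm h)
  obtain ⟨a, ha, haY⟩ : ∃ a, r u a ∧ a ∉ Y := by
    by_contra! h
    exact hYu (hY.1.antisymm h)
  have hmem : ∀ x, r u x → x ∈ X ∨ x ∈ Y := fun x hx => by
    have : x ∈ X ∪ Y := hXY ▸ hx
    exact this
  have hbY : b ∈ Y := (hmem b hb).resolve_left hbX
  -- Adjacency between `Y` and its complement is constant: replace `y` by `b` inside the module `Y`,
  -- then `x` by `v` inside the module `X`.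
  have key : ∀ x, r u x → x ∉ Y → ∀ y ∈ Y, (G.Adj x y ↔ G.Adj v b) := by
    intro x hx hxY y hy
    have hxX := (hmem x hx).resolve_right hxY
    rw [hY.2 x hx hxY y hy b hbY, G.adj_comm x b, hX.2 b hb hbX x hxX v hvX, G.adj_comm]
  have hE : ∀ E : V → V → Prop, Linked r E a b → ¬ ∀ x ∉ Y, ∀ y ∈ Y, r u x → ¬ E x y := by
    intro E hab h
    refine (hab.invariant (P := fun x => r u x ∧ x ∉ Y) ?_ ⟨ha, haY⟩).2 hbY
    exact fun x y hx hxy hE => ⟨hr.trans hx.1 hxy, fun hy => h x hx.2 y hy hx.1 hE⟩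
  -- Either value of this constant separates `a` from `b`, in the complement or in the graph.
  by_cases hvb : G.Adj v b
  · exact hE _ (h₂ a b ha hb) fun x hx y hy hux h => h ((key x hux hx y hy).2 hvb)
  · exact hE _ (h₁ a b ha hb) fun x hx y hy hux h => hvb ((key x hux hx y hy).1 h)

/-- A vertex outside both modules sees every element of either as it sees the common element `v`. -/
lemma isModuleIn_union {u v : V} {X Y : Set V} (hX : IsModuleIn G {x | r u x} X)
    (hY : IsModuleIn G {x | r u x} Y) (hvX : v ∈ X) (hvY : v ∈ Y) :
    IsModuleIn G {x | r u x} (X ∪ Y) := by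
  refine ⟨Set.union_subset hX.1 hY.1, fun z hz hzXY x hx y hy => ?_⟩
  have hzX : z ∉ X := fun h => hzXY (.inl h)
  have hzY : z ∉ Y := fun h => hzXY (.inr h)
  have key : ∀ x ∈ X ∪ Y, (G.Adj z x ↔ G.Adj z v) := by
    rintro x (hx | hx)
    · exact hX.2 z hz hzX x hx v hvX
    · exact hY.2 z hz hzY x hx v hvY
  rw [key x hx, key y hy]

/-- A connected and co-connected class with at least two elements has a greatest proper module
around each of its elements. -/
lemma exists_greatest_isModuleIn [Finite V] (hr : Equivalence r) {u v w : V} (hv : r u v)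
    (hw : r u w) (hvw : v ≠ w)
    (h₁ : ∀ x y, r u x → r u y → Linked r G.Adj x y)
    (h₂ : ∀ x y, r u x → r u y → Linked r (NonAdj G) x y) :
    ∃ X, IsModuleIn G {x | r u x} X ∧ X ≠ {x | r u x} ∧ v ∈ X ∧
      ∀ Y, IsModuleIn G {x | r u x} Y → Y ≠ {x | r u x} → v ∈ Y → Y ⊆ X := by
  let C : Set (Set V) := {X | IsModuleIn G {x | r u x} X ∧ X ≠ {x | r u x} ∧ v ∈ X}
  have hC : C.Nonempty := by
    refine ⟨{v}, ⟨by simpa using hv, ?_⟩, ?_, rfl⟩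
    · rintro z - - x rfl y rfl
      rfl
    · intro h
      have : w ∈ ({v} : Set V) := h ▸ hw
      exact hvw this.symm
  obtain ⟨X, hX⟩ := (Set.toFinite C).exists_maximal hC
  refine ⟨X, hX.prop.1, hX.prop.2.1, hX.prop.2.2, fun Y hY hYu hvY => ?_⟩
  -- The union is again a proper module through `v`, so maximality of `X` absorbs `Y`.
  have : X ∪ Y ∈ C := ⟨isModuleIn_union hX.prop.1 hY hX.prop.2.2 hvY,
    union_ne_of_isModuleIn hr h₁ h₂ hX.prop.1 hY hX.prop.2.2 hX.prop.2.1 hYu, .inl hX.prop.2.2⟩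
  exact Set.subset_union_right.trans (hX.le_of_ge this Set.subset_union_left)

/-! ### Properties of a single split -/

/-- The three ways in which `split` acts on the class of `u`. -/
lemma split_cases (hr : Equivalence r) (u : V) :
    ((∀ x y, r u x → (split G r x y ↔ Linked r G.Adj x y)) ∧ Disconnected r G.Adj u) ∨
    ((∀ x y, r u x → (split G r x y ↔ Linked r (NonAdj G) x y)) ∧ Disconnected r (NonAdj G) u) ∨
    ((∀ x y, r u x → r u y → Linked r G.Adj x y) ∧
      (∀ x y, r u x → r u y → Linked r (NonAdj G) x y) ∧
      ∀ x y, r u x → (split G r x y ↔ r u y ∧ (x = y ∨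
        ∃ X, IsModuleIn G {x | r u x} X ∧ X ≠ {x | r u x} ∧ x ∈ X ∧ y ∈ X))) := by
  have hs₁ : ∀ {x y}, G.Adj x y → G.Adj y x := fun h => h.symm
  have hs₂ : ∀ {x y}, NonAdj G x y → NonAdj G y x := nonAdj_symm
  by_cases h₁ : Disconnected r G.Adj u
  · refine .inl ⟨fun x y hx => ?_, h₁⟩
    have h₁x := (disconnected_congr hr hs₁ hx).1 h₁
    simp only [split, h₁x, true_and, not_true, false_and, or_false]
    exact ⟨fun h => h.2, fun h => ⟨h.rel hr, h⟩⟩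
  by_cases h₂ : Disconnected r (NonAdj G) u
  · refine .inr (.inl ⟨fun x y hx => ?_, h₂⟩)
    have h₁x := mt (disconnected_congr hr hs₁ hx).2 h₁
    have h₂x := (disconnected_congr hr hs₂ hx).1 h₂
    simp only [split, h₁x, h₂x, true_and, not_true, not_false_eq_true, false_and, or_false,
      false_or]
    exact ⟨fun h => h.2, fun h => ⟨h.rel hr, h⟩⟩
  refine .inr (.inr ⟨fun x y => linked_of_not_disconnected hr hs₁ h₁,
    fun x y => linked_of_not_disconnected hr hs₂ h₂, fun x y hx => ?_⟩)
  have h₁x := mt (disconnected_congr hr hs₁ hx).2 h₁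
  have h₂x := mt (disconnected_congr hr hs₂ hx).2 h₂
  have hset : {z | r x z} = {z | r u z} :=
    Set.ext fun z => ⟨fun h => hr.trans hx h, fun h => hr.trans (hr.symm hx) h⟩
  simp only [split, h₁x, h₂x, not_false_eq_true, true_and, false_and, false_or]
  constructor
  · rintro ⟨hxy, h⟩
    refine ⟨hr.trans hx hxy, h.imp_right ?_⟩
    rintro ⟨z, hxz, hz⟩
    -- The least module containing `x` and `y` is proper because it misses the given `z`.
    refine ⟨{z | ModuleClosure G r x y z}, hset ▸ isModuleIn_moduleClosure hr hxy, ?_, .left,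
      .right⟩
    intro h
    have : z ∈ {z | r u z} := hr.trans hx hxz
    rw [← h] at this
    exact hz this
  · rintro ⟨hy, h⟩
    refine ⟨hr.trans (hr.symm hx) hy, h.imp_right ?_⟩
    rintro ⟨X, hX, hXu, hxX, hyX⟩
    obtain ⟨z, hz, hzX⟩ : ∃ z, r u z ∧ z ∉ X := by
      by_contra! h
      exact hXu (hX.1.antisymm h)
    exact ⟨z, hr.trans (hr.symm hx) hz,
      fun h => hzX (moduleClosure_subset (hset ▸ hX) hxX hyX h)⟩

/-- Reachability settles the first two cases. In the third, transitivity rests on connectedness and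
co-connectedness: two proper modules that share `y` have a proper module as their union. -/
lemma equivalence_split [Finite V] (hr : Equivalence r) : Equivalence (split G r) := by
  have main : ∀ u, (∀ x, r u x → split G r x x) ∧
      (∀ x y, r u x → split G r x y → split G r y x) ∧
      ∀ x y z, r u x → split G r x y → split G r y z → split G r x z := by
    intro u
    rcases split_cases (G := G) hr u with ⟨h, -⟩ | ⟨h, -⟩ | ⟨h₁, h₂, h⟩
    · refine ⟨fun x hx => (h x x hx).2 .refl, fun x y hx hxy => ?_, fun x y z hx hxy hyz => ?_⟩
      · exact (h y x (hr.trans hx hxy.1)).2 (((h x y hx).1 hxy).symm hr fun h => h.symm)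
      · exact (h x z hx).2 (((h x y hx).1 hxy).trans ((h y z (hr.trans hx hxy.1)).1 hyz))
    · refine ⟨fun x hx => (h x x hx).2 .refl, fun x y hx hxy => ?_, fun x y z hx hxy hyz => ?_⟩
      · exact (h y x (hr.trans hx hxy.1)).2 (((h x y hx).1 hxy).symm hr nonAdj_symm)
      · exact (h x z hx).2 (((h x y hx).1 hxy).trans ((h y z (hr.trans hx hxy.1)).1 hyz))
    · refine ⟨fun x hx => (h x x hx).2 ⟨hx, .inl rfl⟩, fun x y hx hxy => ?_,
        fun x y z hx hxy hyz => ?_⟩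
      · have hy := hr.trans hx hxy.1
        refine (h y x hy).2 ⟨hx, ?_⟩
        rcases ((h x y hx).1 hxy).2 with rfl | ⟨X, hX, hXu, hxX, hyX⟩
        · exact .inl rfl
        · exact .inr ⟨X, hX, hXu, hyX, hxX⟩
      · have hy := hr.trans hx hxy.1
        have hz := hr.trans hy hyz.1
        refine (h x z hx).2 ⟨hz, ?_⟩
        rcases ((h x y hx).1 hxy).2 with rfl | ⟨X, hX, hXu, hxX, hyX⟩
        · exact ((h x z hx).1 hyz).2
        rcases ((h y z hy).1 hyz).2 with rfl | ⟨Y, hY, hYu, hyY, hzY⟩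
        · exact ((h x y hx).1 hxy).2
        exact .inr ⟨X ∪ Y, isModuleIn_union hX hY hyX hyY,
          union_ne_of_isModuleIn hr h₁ h₂ hX hY hyX hXu hYu, .inl hxX, .inr hzY⟩
  exact ⟨fun x => (main x).1 x (hr.refl x), fun {x y} h => (main x).2.1 x y (hr.refl x) h,
    fun {x y z} h h' => (main x).2.2 x y z (hr.refl x) h h'⟩

/-- The classes of `split` are modules of the classes of `r`. -/
lemma split_adj_iff [Finite V] (hr : Equivalence r) {x y z : V} (hxy : split G r x y)
    (hz : r x z) (hxz : ¬ split G r x z) : G.Adj z x ↔ G.Adj z y := by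
  have hs := equivalence_split (G := G) hr
  have hyz : ¬ split G r y z := fun h => hxz (hs.trans hxy h)
  rcases split_cases (G := G) hr x with ⟨h, -⟩ | ⟨h, -⟩ | ⟨h₁, h₂, h⟩
  · have : ∀ y, r x y → ¬ split G r y z → ¬ G.Adj z y := fun y hy hyz h' =>
      hyz ((h y z hy).2 (.single ⟨hr.trans (hr.symm hy) hz, h'.symm⟩))
    simp [this x (hr.refl x) hxz, this y hxy.1 hyz]
  · have : ∀ y, r x y → ¬ split G r y z → G.Adj z y := fun y hy hyz => by
      by_contra h'
      exact hyz ((h y z hy).2 (.single ⟨hr.trans (hr.symm hy) hz, fun h => h' h.symm⟩))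
    simp [this x (hr.refl x) hxz, this y hxy.1 hyz]
  · rcases ((h x y (hr.refl x)).1 hxy).2 with rfl | ⟨X, hX, hXu, hxX, hyX⟩
    · rfl
    · refine hX.2 z hz (fun hzX => hxz ?_) x hxX y hyX
      exact (h x z (hr.refl x)).2 ⟨hz, .inr ⟨X, hX, hXu, hxX, hzX⟩⟩

/-- A class with at least two elements is split. -/
lemma exists_not_split [Finite V] (hr : Equivalence r) {u v : V} (huv : r u v) (hne : u ≠ v) :
    ∃ z, r u z ∧ ¬ split G r u z := by
  rcases split_cases (G := G) hr u with ⟨h, z, hz, hz'⟩ | ⟨h, z, hz, hz'⟩ | ⟨h₁, h₂, h⟩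
  · exact ⟨z, hz, fun h' => hz' ((h u z (hr.refl u)).1 h')⟩
  · exact ⟨z, hz, fun h' => hz' ((h u z (hr.refl u)).1 h')⟩
  · obtain ⟨X, hX, hXu, huX, hmax⟩ := exists_greatest_isModuleIn hr (hr.refl u) huv hne h₁ h₂
    obtain ⟨z, hz, hzX⟩ : ∃ z, r u z ∧ z ∉ X := by
      by_contra! h
      exact hXu (hX.1.antisymm h)
    refine ⟨z, hz, fun hs => ?_⟩
    rcases ((h u z (hr.refl u)).1 hs).2 with rfl | ⟨Y, hY, hYu, huY, hzY⟩
    · exact hzX huX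
    · exact hzX (hmax Y hY hYu huY hzY)

/-- The quotient of a class of `r` by `split` is empty, complete or prime. -/
lemma split_trichotomy (hr : Equivalence r) (u : V) :
    (∀ x y, r u x → r u y → ¬ split G r x y → ¬ G.Adj x y) ∨
    (∀ x y, r u x → r u y → ¬ split G r x y → G.Adj x y) ∨
    ∀ X, IsModuleIn G {x | r u x} X → X ≠ {x | r u x} → ∀ x ∈ X, ∀ y ∈ X, split G r x y := by
  rcases split_cases (G := G) hr u with ⟨h, -⟩ | ⟨h, -⟩ | ⟨h₁, h₂, h⟩
  · refine .inl fun x y hx hy hxy h' => hxy ((h x y hx).2 ?_)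
    exact .single ⟨hr.trans (hr.symm hx) hy, h'⟩
  · refine .inr (.inl fun x y hx hy hxy => ?_)
    by_contra h'
    exact hxy ((h x y hx).2 (.single ⟨hr.trans (hr.symm hx) hy, h'⟩))
  · exact .inr (.inr fun X hX hXu x hx y hy =>
      (h x y (hX.1 hx)).2 ⟨hX.1 hy, .inr ⟨X, hX, hXu, hx, hy⟩⟩)

/-! ### The decomposition tree and its depth -/

/-- The equivalence relations on the levels of the decomposition tree. -/
def level (G : SimpleGraph V) : ℕ → V → V → Prop
  | 0 => fun _ _ => True
  | d + 1 => split G (level G d)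

lemma equivalence_level [Finite V] (G : SimpleGraph V) (d : ℕ) : Equivalence (level G d) := by
  induction d with
  | zero => exact ⟨fun _ => trivial, fun _ => trivial, fun _ _ => trivial⟩
  | succ d ih => exact equivalence_split ih

/-- By `exists_not_split` the class of `u` loses at least one vertex per level until it is a
singleton. -/
lemma ncard_level_le [Finite V] (G : SimpleGraph V) (d : ℕ) (u : V) :
    {v | level G d u v}.ncard ≤ max 1 (Nat.card V - d) := by
  induction d with
  | zero => simp [level, Set.ncard_univ]
  | succ d ih =>
    have hd := equivalence_level G d
    have hd' := equivalence_level G (d + 1)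
    by_cases h : ∃ v, level G d u v ∧ u ≠ v
    · obtain ⟨v, huv, hne⟩ := h
      obtain ⟨z, hz, hz'⟩ := exists_not_split (G := G) hd huv hne
      have : {v | level G (d + 1) u v}.ncard < {v | level G d u v}.ncard := by
        refine Set.ncard_lt_ncard ⟨fun x hx => hx.1, fun h => hz' (h hz)⟩ (Set.toFinite _)
      omega
    · push Not at h
      have : {v | level G (d + 1) u v} = {u} := by
        ext v
        exact ⟨fun hv => (h v hv.1).symm, fun hv => by rw [hv]; exact hd'.refl u⟩
      rw [this, Set.ncard_singleton]
      exact le_max_left _ _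

lemma level_card_iff [Finite V] (G : SimpleGraph V) {u v : V} :
    level G (Nat.card V) u v ↔ u = v := by
  have h := equivalence_level G (Nat.card V)
  constructor
  · intro huv
    have := ncard_level_le G (Nat.card V) u
    rw [Nat.sub_self, max_eq_left zero_le_one, Set.ncard_le_one_iff] at this
    exact this (h.refl u) huv
  · rintro rfl
    exact h.refl u

end Splitting
end FPC

namespace FPC

/-! ### Reconstructing a realizer of a quotient -/

section Reconstruction

variable {V : Type} {G : SimpleGraph V} {M : V → Prop} {s : V → V → Prop}

/-- The relations reconstructed on the quotient of `M` by `s` from the class of `w`. The first one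
carries the tag `true`, the second one the tag `false`. -/
inductive Rec (G : SimpleGraph V) (M : V → Prop) (s : V → V → Prop) (w : V) :
    Bool → V → V → Prop
  | base {u v : V} (hu : M u) (hv : M v) (hwu : s w u) (hwv : ¬ s w v) : Rec G M s w true u v
  | adj {b : Bool} {u v : V} (h : Rec G M s w b u v) (huv : G.Adj u v) : Rec G M s w (!b) v u
  | nadj {b : Bool} {u v : V} (h : Rec G M s w b u v) (huv : ¬ G.Adj u v) : Rec G M s w (!b) u v
  | trans {b : Bool} {u v z : V} (h : Rec G M s w b u v) (h' : Rec G M s w b v z) :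
      Rec G M s w b u z

lemma Rec.mem {w : V} {b : Bool} {u v : V} (h : Rec G M s w b u v) : M u ∧ M v := by
  induction h with
  | base hu hv => exact ⟨hu, hv⟩
  | adj _ _ ih => exact ih.symm
  | nadj _ _ ih => exact ih
  | trans _ _ ih ih' => exact ⟨ih.1, ih'.2⟩

/-- The formulas encode the tag by equality of two vertices, and the tag `false` then needs two
distinct ones. -/
lemma Rec.nontrivial {w : V} {b : Bool} {u v : V} (h : Rec G M s w b u v) : Nontrivial V := by
  induction h with
  | @base u v _ _ hwu hwv => exact ⟨u, v, fun h => hwv (h ▸ hwu)⟩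
  | adj _ _ ih => exact ih
  | nadj _ _ ih => exact ih
  | trans _ _ ih _ => exact ih

/-- Comparability passes from either relation to the other, possibly with the direction reversed. -/
lemma Rec.not {w : V} {b : Bool} {u v : V} (h : Rec G M s w b u v) :
    Rec G M s w (!b) u v ∨ Rec G M s w (!b) v u := by
  by_cases huv : G.Adj u v
  · exact .inr (h.adj huv)
  · exact .inl (h.nadj huv)

lemma IsRealizer.asymm₁ {lt₁ lt₂ : V → V → Prop} (h : IsRealizer G lt₁ lt₂) {u v : V}
    (huv : lt₁ u v) : ¬ lt₁ v u :=
  haveI := h.1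
  fun hvu => irrefl_of lt₁ u (trans_of lt₁ huv hvu)

lemma IsRealizer.asymm₂ {lt₁ lt₂ : V → V → Prop} (h : IsRealizer G lt₁ lt₂) {u v : V}
    (huv : lt₂ u v) : ¬ lt₂ v u :=
  haveI := h.2.1
  fun hvu => irrefl_of lt₂ u (trans_of lt₂ huv hvu)

/-- The data from which a realizer of the quotient is reconstructed: the classes of `s` are modules
of `M` with representatives, and `w` represents the first class. -/
structure RecData (G : SimpleGraph V) (M : V → Prop) (s : V → V → Prop) (lt₁ lt₂ : V → V → Prop)
    (rep : V → V) (w : V) : Prop where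
  realizer : IsRealizer G lt₁ lt₂
  equiv : Equivalence s
  module : ∀ {x y z}, M x → M y → M z → s x y → ¬ s x z → (G.Adj z x ↔ G.Adj z y)
  rep_mem : ∀ {x}, M x → M (rep x)
  rep_rel : ∀ x, s x (rep x)
  rep_eq : ∀ {x y}, s x y → rep x = rep y
  rep_first : rep w = w
  mem_first : M w
  first : ∀ {x}, M x → x ≠ w → lt₁ w x
  prime : ∀ X : Set V, IsModuleIn G {x | M x} X → X ≠ {x | M x} → ∀ x ∈ X, ∀ y ∈ X, s x y

namespace RecData

variable {lt₁ lt₂ : V → V → Prop} {rep : V → V} {w : V}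

lemma rep_eq_iff (h : RecData G M s lt₁ lt₂ rep w) {x y : V} : rep x = rep y ↔ s x y := by
  refine ⟨fun hxy => ?_, h.rep_eq⟩
  exact h.equiv.trans (h.rep_rel x) (hxy ▸ h.equiv.symm (h.rep_rel y))

lemma adj_rep (h : RecData G M s lt₁ lt₂ rep w) {x y : V} (hx : M x) (hy : M y)
    (hxy : ¬ s x y) : G.Adj (rep x) (rep y) ↔ G.Adj x y := by
  rw [← h.module hy (h.rep_mem hy) (h.rep_mem hx) (h.rep_rel y), G.adj_comm,
    ← h.module hx (h.rep_mem hx) hy (h.rep_rel x) hxy, G.adj_comm]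
  exact fun h' => hxy (h.equiv.symm (h.equiv.trans h' (h.equiv.symm (h.rep_rel x))))

/-- The two orders of a realizer disagree exactly on the adjacent pairs, so each transfer rule is
forced; the base rule holds because `w` precedes all other vertices of `M` in `lt₁`. -/
lemma sound (h : RecData G M s lt₁ lt₂ rep w) {b : Bool} {u v : V} (huv : Rec G M s w b u v) :
    (bif b then lt₁ else lt₂) (rep u) (rep v) := by
  have h₁ := h.realizer.1
  have h₂ := h.realizer.2.1
  have hne : ∀ {b : Bool} {u v : V}, (bif b then lt₁ else lt₂) (rep u) (rep v) → ¬ s u v := by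
    intro b u v huv hs
    rw [h.rep_eq hs] at huv
    cases b
    · exact irrefl_of lt₂ _ huv
    · exact irrefl_of lt₁ _ huv
  induction huv with
  | base hu hv hwu hwv =>
    rw [← h.rep_eq hwu, h.rep_first]
    refine h.first (h.rep_mem hv) fun h' => hwv ?_
    rw [← h.rep_eq_iff, h', h.rep_first]
  | @adj b u v huv hadj ih =>
    have := (h.adj_rep huv.mem.1 huv.mem.2 (hne ih)).2 hadj
    rcases (h.realizer.2.2 _ _).1 this with h' | h' <;> cases b
    · exact absurd ih (h.realizer.asymm₂ h'.2)
    · exact h'.2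
    · exact h'.1
    · exact absurd ih (h.realizer.asymm₁ h'.1)
  | @nadj b u v huv hadj ih =>
    have hs := hne ih
    have := mt (h.adj_rep huv.mem.1 huv.mem.2 hs).1 hadj
    rw [h.realizer.2.2] at this
    have hr : rep u ≠ rep v := fun h' => hs (h.rep_eq_iff.1 h')
    cases b
    · rcases trichotomous_of lt₁ (rep u) (rep v) with h' | h' | h'
      · exact h'
      · exact absurd h' hr
      · exact absurd (.inr ⟨h', ih⟩) this
    · rcases trichotomous_of lt₂ (rep u) (rep v) with h' | h' | h'
      · exact h'
      · exact absurd h' hr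
      · exact absurd (.inl ⟨ih, h'⟩) this
  | @trans b u v z _ _ ih ih' =>
    cases b
    · exact trans_of lt₂ ih ih'
    · exact trans_of lt₁ ih ih'

lemma asymm (h : RecData G M s lt₁ lt₂ rep w) {b : Bool} {u v : V} (huv : Rec G M s w b u v) :
    ¬ Rec G M s w b v u := by
  intro hvu
  have h₁ := h.sound huv
  have h₂ := h.sound hvu
  cases b
  · exact h.realizer.asymm₂ h₁ h₂
  · exact h.realizer.asymm₁ h₁ h₂

lemma adj_iff (h : RecData G M s lt₁ lt₂ rep w) {b : Bool} {u v : V}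
    (huv : Rec G M s w b u v) : G.Adj u v ↔ Rec G M s w (!b) v u :=
  ⟨huv.adj, fun hvu => by
    by_contra hadj
    exact h.asymm hvu (huv.nadj hadj)⟩

/-- The component of `u` under incomparability is a module, because an outside vertex lies on one
side of it in each of the two relations. It avoids `w`, hence is proper, and primality puts `u` and
`v` into one class. -/
lemma total (h : RecData G M s lt₁ lt₂ rep w) {u v : V} (hu : M u) (hv : M v) (hs : ¬ s u v) :
    Rec G M s w true u v ∨ Rec G M s w true v u := by
  by_contra hinc
  let inc : V → V → Prop := fun x y => M x ∧ M y ∧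
    ¬ (Rec G M s w true x y ∨ Rec G M s w true y x)
  let X : Set V := {x | Relation.ReflTransGen inc u x}
  have hXM : ∀ x ∈ X, M x := by
    intro x hx
    rcases Relation.ReflTransGen.cases_tail hx with rfl | ⟨y, _, hy⟩
    · exact hu
    · exact hy.2.1
  have hcomp : ∀ z, M z → z ∉ X → ∀ x ∈ X, Rec G M s w true z x ∨ Rec G M s w true x z := by
    intro z hz hzX x hx
    by_contra h'
    exact hzX (Relation.ReflTransGen.tail hx ⟨hXM x hx, hz, fun h'' => h' h''.symm⟩)
  have hfalse : ∀ {b x y}, Rec G M s w b x y → Rec G M s w true x y ∨ Rec G M s w true y x := by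
    intro b x y hxy
    cases b
    · exact hxy.not
    · exact .inl hxy
  have hmod : IsModuleIn G {x | M x} X := by
    refine ⟨hXM, fun z hz hzX => ?_⟩
    have key : ∀ x, Relation.ReflTransGen inc u x → (G.Adj z x ↔ G.Adj z u) := by
      intro x hx
      induction hx with
      | refl => rfl
      | @tail x y hx hxy ih =>
        rw [← ih]
        have hy : y ∈ X := Relation.ReflTransGen.tail hx hxy
        have hzx := hcomp z hz hzX x hx
        have hzy := hcomp z hz hzX y hy
        -- By transitivity `z` cannot lie between the incomparable `x` and `y` in either relation.
        have hlt : ∀ b, Rec G M s w b x z → Rec G M s w b z y → False :=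
          fun b h₁ h₂ => hxy.2.2 (hfalse (h₁.trans h₂))
        have hgt : ∀ b, Rec G M s w b y z → Rec G M s w b z x → False :=
          fun b h₁ h₂ => hxy.2.2 (hfalse (h₁.trans h₂)).symm
        rcases hzx with hzx | hzx
        · have hzy := hzy.resolve_right fun h' => hgt _ h' hzx
          -- With `z` on the same side of both in the first relation, adjacency means the opposite
          -- side in the second, where `x` and `y` agree as well.
          rw [h.adj_iff hzx, h.adj_iff hzy]
          constructor
          · intro h'
            exact hzx.not.resolve_left fun h'' => hgt _ h' h''
          · intro h'
            exact hzy.not.resolve_left fun h'' => hlt _ h' h''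
        · have hzy := hzy.resolve_left fun h' => hlt _ hzx h'
          rw [G.adj_comm z x, G.adj_comm z y, h.adj_iff hzx, h.adj_iff hzy]
          constructor
          · intro h'
            exact hzx.not.resolve_left fun h'' => hlt _ h'' h'
          · intro h'
            exact hzy.not.resolve_left fun h'' => hgt _ h'' h'
    intro x hx y hy
    rw [key x hx, key y hy]
  have hsymm : ∀ {x y}, inc x y → inc y x := fun h => ⟨h.2.1, h.1, fun h' => h.2.2 h'.symm⟩
  -- The base rule compares the class of `w` with everything outside it, so a component through `w`
  -- stays inside that class and cannot contain both `u` and `v`.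
  have hXw : w ∉ X := by
    intro hwX
    have hcl : ∀ x y, s w x → inc x y → s w y := by
      intro x y hwx hxy
      by_contra hs
      exact hxy.2.2 (.inl (.base hxy.1 hxy.2.1 hwx hs))
    have hback : ∀ x, Relation.ReflTransGen inc w x → s w x := by
      intro x hx
      induction hx with
      | refl => exact h.equiv.refl w
      | tail _ h' ih => exact hcl _ _ ih h'
    have hrev : ∀ x, Relation.ReflTransGen inc u x → Relation.ReflTransGen inc x u := by
      intro x hx
      induction hx with
      | refl => exact .refl
      | tail _ h' ih => exact .head (hsymm h') ih
    have hwu := hrev w hwX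
    have hwv : Relation.ReflTransGen inc w v := hwu.tail ⟨hu, hv, hinc⟩
    exact hs (h.equiv.trans (h.equiv.symm (hback u hwu)) (hback v hwv))
  refine hs (h.prime X hmod (fun h' => hXw ?_) u .refl v (.single ⟨hu, hv, hinc⟩))
  rw [h']
  exact h.mem_first

/-- The reconstructed relations are the realizer of the quotient. -/
lemma rec_iff (h : RecData G M s lt₁ lt₂ rep w) {b : Bool} {u v : V} (hu : M u) (hv : M v) :
    Rec G M s w b u v ↔ (bif b then lt₁ else lt₂) (rep u) (rep v) := by
  refine ⟨h.sound, fun huv => ?_⟩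
  have h₁ := h.realizer.1
  have h₂ := h.realizer.2.1
  have hs : ¬ s u v := by
    intro hs
    rw [h.rep_eq hs] at huv
    cases b
    · exact irrefl_of lt₂ _ huv
    · exact irrefl_of lt₁ _ huv
  have htot : Rec G M s w b u v ∨ Rec G M s w b v u := by
    cases b
    · rcases h.total hu hv hs with h' | h'
      · exact h'.not
      · exact h'.not.symm
    · exact h.total hu hv hs
  refine htot.resolve_right fun hvu => ?_
  have := h.sound hvu
  cases b
  · exact h.realizer.asymm₂ huv this
  · exact h.realizer.asymm₁ huv this

end RecData

lemma IsRealizer.exists_first {lt₁ lt₂ : V → V → Prop} [Finite V] (h : IsRealizer G lt₁ lt₂)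
    {u : V} (hu : M u) : ∃ w, M w ∧ ∀ {x}, M x → x ≠ w → lt₁ w x := by
  have := h.1
  have hwf : WellFounded lt₁ := Finite.wellFounded_of_trans_of_irrefl lt₁
  obtain ⟨w, hw, hmin⟩ := hwf.has_min {x | M x} ⟨u, hu⟩
  refine ⟨w, hw, fun {x} hx hne => ?_⟩
  rcases trichotomous_of lt₁ w x with h' | h' | h'
  · exact h'
  · exact absurd h'.symm hne
  · exact absurd h' (hmin x hx)

/-- Some start vertex reconstructs a linear order of the quotient. -/
lemma exists_rec_iff {lt₁ lt₂ : V → V → Prop} [Finite V] (h : IsRealizer G lt₁ lt₂)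
    (hs : Equivalence s) (hsM : ∀ {x y}, s x y → M x → M y)
    (hmod : ∀ {x y z}, M x → M y → M z → s x y → ¬ s x z → (G.Adj z x ↔ G.Adj z y))
    (hprime : ∀ X : Set V, IsModuleIn G {x | M x} X → X ≠ {x | M x} → ∀ x ∈ X, ∀ y ∈ X, s x y)
    {u : V} (hu : M u) :
    ∃ (w : V) (rep : V → V), M w ∧ (∀ x y, rep x = rep y ↔ s x y) ∧
      ∀ x y, M x → M y → (Rec G M s w true x y ↔ lt₁ (rep x) (rep y)) := by
  classical
  obtain ⟨w, hw, hfirst⟩ := h.exists_first (M := M) hu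
  let S : Setoid V := ⟨s, hs⟩
  let out : V → V := fun x => (Quotient.mk S x).out
  have hout : ∀ x, s x (out x) := fun x => hs.symm (Quotient.mk_out (s := S) x)
  have hout' : ∀ {x y}, s x y → out x = out y := fun {x y} hxy => by
    have : Quotient.mk S x = Quotient.mk S y := Quotient.sound hxy
    simp only [out, this]
  -- The class of `w` must be represented by `w` itself, the `lt₁`-least vertex of `M`; any
  -- representative does for the other classes.
  let rep : V → V := fun x => if s w x then w else out x
  have hrel : ∀ x, s x (rep x) := fun x => by
    by_cases hwx : s w x
    · simpa only [rep, if_pos hwx] using hs.symm hwx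
    · simpa only [rep, if_neg hwx] using hout x
  have H : RecData G M s lt₁ lt₂ rep w :=
    { realizer := h
      equiv := hs
      module := hmod
      rep_mem := fun {x} hx => hsM (hrel x) hx
      rep_rel := hrel
      rep_eq := fun {x y} hxy => by
        have : s w x ↔ s w y := ⟨fun h => hs.trans h hxy, fun h => hs.trans h (hs.symm hxy)⟩
        simp only [rep, this, hout' hxy]
      rep_first := by simp only [rep, if_pos (hs.refl w)]
      mem_first := hw
      first := hfirst
      prime := hprime }
  exact ⟨w, rep, hw, fun x y => H.rep_eq_iff, fun x y hx hy => H.rec_iff hx hy⟩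

/-! ### The stages of the reconstruction on a graph -/

lemma stage_le_succ (w : V) (k : ℕ) {u v : V} :
    ((stage G w k).1 u v → (stage G w (k + 1)).1 u v) ∧
      ((stage G w k).2 u v → (stage G w (k + 1)).2 u v) :=
  ⟨fun h => .single (.inl h), fun h => .single (.inl h)⟩

lemma stage_mono (w : V) {k l : ℕ} (hkl : k ≤ l) {u v : V} :
    ((stage G w k).1 u v → (stage G w l).1 u v) ∧
      ((stage G w k).2 u v → (stage G w l).2 u v) := by
  induction hkl with
  | refl => exact ⟨id, id⟩
  | step _ ih =>
    exact ⟨fun h => (stage_le_succ w _).1 (ih.1 h), fun h => (stage_le_succ w _).2 (ih.2 h)⟩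

/-- The component of a stage with the given tag. -/
def stageComp (G : SimpleGraph V) (w : V) (k : ℕ) (b : Bool) : V → V → Prop :=
  bif b then (stage G w k).1 else (stage G w k).2

lemma stageComp_mono (w : V) {k l : ℕ} (hkl : k ≤ l) {b : Bool} {u v : V}
    (h : stageComp G w k b u v) : stageComp G w l b u v := by
  cases b
  · exact (stage_mono w hkl).2 h
  · exact (stage_mono w hkl).1 h

lemma stageComp_succ (w : V) (k : ℕ) (b : Bool) :
    stageComp G w (k + 1) b =
      Relation.TransGen (edgeClosure G (stageComp G w k b) (stageComp G w k (!b))) := by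
  cases b <;> rfl

/-- Applying the rules in rounds or in any order derives the same pairs: the stages increase, so the
premises of a rule are available at a common stage. -/
lemma exists_stageComp_iff {w : V} {b : Bool} {u v : V} :
    (∃ k, stageComp G w k b u v) ↔ Rec G (fun _ => True) Eq w b u v := by
  constructor
  · rintro ⟨k, h⟩
    induction k generalizing b u v with
    | zero =>
      cases b
      · exact h.elim
      · exact .base trivial trivial h.1.symm fun h' => h.2 h'.symm
    | succ k ih =>
      rw [stageComp_succ] at h
      have key : ∀ {u v}, edgeClosure G (stageComp G w k b) (stageComp G w k (!b)) u v →
          Rec G (fun _ => True) Eq w b u v := by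
        rintro u v (h | ⟨h, huv⟩ | ⟨h, huv⟩)
        · exact ih h
        · simpa using (ih h).adj huv.symm
        · simpa using (ih h).nadj huv
      induction h with
      | single h => exact key h
      | tail _ h ih => exact ih.trans (key h)
  · intro h
    induction h with
    | base _ _ h h' => exact ⟨0, h.symm, fun h'' => h' h''.symm⟩
    | adj _ huv ih =>
      obtain ⟨k, ih⟩ := ih
      refine ⟨k + 1, ?_⟩
      rw [stageComp_succ]
      exact .single (.inr (.inl ⟨by simpa using ih, huv.symm⟩))
    | nadj _ huv ih =>
      obtain ⟨k, ih⟩ := ih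
      refine ⟨k + 1, ?_⟩
      rw [stageComp_succ]
      exact .single (.inr (.inr ⟨by simpa using ih, huv⟩))
    | trans _ _ ih ih' =>
      obtain ⟨k, ih⟩ := ih
      obtain ⟨l, ih'⟩ := ih'
      refine ⟨max k l + 1, ?_⟩
      rw [stageComp_succ]
      exact .trans (.single (.inl (stageComp_mono w (le_max_left k l) ih)))
        (.single (.inl (stageComp_mono w (le_max_right k l) ih')))

lemma reconstruct₁_iff {w u v : V} :
    reconstruct₁ G w u v ↔ Rec G (fun _ => True) Eq w true u v :=
  exists_stageComp_iff (b := true)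

lemma reconstruct₂_iff {w u v : V} :
    reconstruct₂ G w u v ↔ Rec G (fun _ => True) Eq w false u v :=
  exists_stageComp_iff (b := false)

/-- A realizer of a prime graph is reconstructed from its first element. -/
lemma reconstruct_eq (hG : IsPrime G) {lt₁ lt₂ : V → V → Prop} (h : IsRealizer G lt₁ lt₂) {w : V}
    (hw : ∀ v, v ≠ w → lt₁ w v) : reconstruct₁ G w = lt₁ ∧ reconstruct₂ G w = lt₂ := by
  have H : RecData G (fun _ => True) Eq lt₁ lt₂ id w :=
    { realizer := h
      equiv := eq_equivalence
      module := by
        rintro x _ z - - - rfl -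
        rfl
      rep_mem := fun _ => trivial
      rep_rel := fun _ => rfl
      rep_eq := fun h => h
      rep_first := rfl
      mem_first := trivial
      first := fun _ => hw _
      prime := by
        intro X hX hXu x hx y hy
        -- `IsModuleIn` admits the empty set but `IsModule` does not; `x` supplies the missing
        -- element.
        rcases hG X ⟨⟨x, hx⟩, fun v hv => hX.2 v trivial hv⟩ with rfl | ⟨z, rfl⟩
        · exact absurd rfl hXu
        · exact hx.trans hy.symm }
  constructor <;> ext u v
  · rw [reconstruct₁_iff]
    exact H.rec_iff trivial trivial
  · rw [reconstruct₂_iff]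
    exact H.rec_iff trivial trivial

end Reconstruction
end FPC

namespace FPC

/-! ### Canonical codes of modules -/

section Codes

variable {V : Type}

/-- Codes of graphs: binary relations on the number sort. -/
abbrev Code (V : Type) : Type := Num V → Num V → Prop

/-- The lexicographic order of codes. -/
def CodeLT (A B : Code V) : Prop :=
  ∃ p q, ¬ A p q ∧ B p q ∧ ∀ p' q', p' < p ∨ (p' = p ∧ q' < q) → (A p' q' ↔ B p' q')

/-- The reflexive lexicographic order of codes. -/
def CodeLE (A B : Code V) : Prop := ¬ CodeLT B A

/-- Codes as a lexicographically ordered type. -/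
def Code.lex (A : Code V) : Lex ((Num V ×ₗ Num V) → Prop) :=
  toLex fun z => A (ofLex z).1 (ofLex z).2

/-- Codes are viewed as functions into `Prop`, ordered by `False < True`; this makes the comparison
of codes linear. -/
lemma codeLT_iff {A B : Code V} : CodeLT A B ↔ A.lex < B.lex := by
  constructor
  · rintro ⟨p, q, hA, hB, h⟩
    refine ⟨toLex (p, q), fun z hz => ?_, ?_⟩
    · exact propext (h _ _ (Prod.Lex.lt_iff.1 hz))
    · exact ⟨fun h => absurd h hA, fun h => hA (h hB)⟩
  · rintro ⟨z, hz, hlt⟩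
    refine ⟨(ofLex z).1, (ofLex z).2, fun h => ?_, ?_, fun p' q' h => ?_⟩
    · exact hlt.2 fun _ => h
    · by_contra h
      exact hlt.2 fun h' => absurd h' h
    · exact iff_of_eq (hz (toLex (p', q')) (Prod.Lex.lt_iff.2 h))

lemma codeLE_iff {A B : Code V} : CodeLE A B ↔ A.lex ≤ B.lex := by
  rw [CodeLE, codeLT_iff]
  exact not_lt

lemma Code.lex_injective : Function.Injective (Code.lex (V := V)) := by
  intro A B h
  funext p q
  exact congrFun (toLex.injective h) (toLex (p, q))

lemma CodeLE.antisymm {A B : Code V} (h : CodeLE A B) (h' : CodeLE B A) : A = B :=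
  Code.lex_injective (le_antisymm (codeLE_iff.1 h) (codeLE_iff.1 h'))

/-- `B` is the code of an ordered copy of the subgraph of `G` induced by `M`. -/
def IsCodeOf (G : SimpleGraph V) (M : V → Prop) (B : Code V) : Prop :=
  ∃ π : V → ℕ, (∀ x y, M x → M y → π x = π y → x = y) ∧ (∀ x, M x → π x < {y | M y}.ncard) ∧
    ∀ p q : Num V, B p q ↔ ∃ x y, M x ∧ M y ∧ π x = p ∧ π y = q ∧ (x = y ∨ G.Adj x y)

/-- The number of vertices in the class of `x`. -/
noncomputable def classSize (s : V → V → Prop) (x : V) : ℕ := {y | s x y}.ncard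

/-- The number of vertices of `M` strictly below `x` in the preorder `P`. -/
noncomputable def lowerCount (M : V → Prop) (P : V → V → Prop) (x : V) : ℕ :=
  {y | M y ∧ P y x ∧ ¬ P x y}.ncard

/-- The number of vertices of `M` below `x` in the preorder `P`. -/
noncomputable def upperCount (M : V → Prop) (P : V → V → Prop) (x : V) : ℕ :=
  {y | M y ∧ P y x}.ncard

/-- `p` is the `i`-th position of the `j`-th class of `s` that is equivalent to `x` in the
preorder `P`. -/
def PlacedAt (M : V → Prop) (s P : V → V → Prop) (x : V) (j i p : Num V) : Prop :=
  (p : ℕ) = lowerCount M P x + j * classSize s x + i ∧ (i : ℕ) < classSize s x ∧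
    (p : ℕ) < upperCount M P x

/-- The code obtained by concatenating the codes `A` of the classes of `s` along `P`. -/
def concat (G : SimpleGraph V) (M : V → Prop) (s : V → V → Prop) (A : V → Code V)
    (P : V → V → Prop) : Code V := fun p q =>
  ∃ x y, (M x ∧ M y) ∧ ∃ j j' i i' : Num V, PlacedAt M s P x j i p ∧ PlacedAt M s P y j' i' q ∧
    ((s x y ∧ j = j' ∧ A x i i') ∨ (¬ s x y ∧ G.Adj x y ∧ (P x y → P y x → j ≠ j')))

/-- `P` is a total preorder of the classes of `s` in `M` whose linear extensions all lead to the
same code. -/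
def IsGoodOrder (G : SimpleGraph V) (M : V → Prop) (s : V → V → Prop) (A : V → Code V)
    (P : V → V → Prop) : Prop :=
  (∀ x y, M x → M y → P x y ∨ P y x) ∧
  (∀ x y z, M x → M y → M z → P x y → P y z → P x z) ∧
  (∀ x y, M x → M y → s x y → P x y) ∧
  (∀ x y, M x → M y → P x y → P y x → ∀ i i', A x i i' ↔ A y i i') ∧
  ∀ x y x' y', M x → M y → M x' → M y' → ¬ s x y → ¬ s x' y' → P x x' → P x' x → P y y' →
    P y' y → (G.Adj x y ↔ G.Adj x' y')

/-! ### Reading the size of a module off its code -/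

lemma exists_eq_of_injective_of_lt [Finite V] {M : V → Prop} {π : V → ℕ}
    (hinj : ∀ x y, M x → M y → π x = π y → x = y) (hlt : ∀ x, M x → π x < {y | M y}.ncard) {k : ℕ}
    (hk : k < {y | M y}.ncard) : ∃ x, M x ∧ π x = k := by
  have : π '' {y | M y} = Set.Iio {y | M y}.ncard := by
    refine Set.eq_of_subset_of_ncard_le (by rintro _ ⟨x, hx, rfl⟩; exact hlt x hx) ?_
      (Set.finite_Iio _)
    have hπ : Set.InjOn π {y | M y} := fun x hx y hy => hinj x y hx hy
    rw [hπ.ncard_image]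
    simp [Set.ncard_eq_toFinset_card']
  have hk' : k ∈ π '' {y | M y} := by rw [this]; exact hk
  exact hk'

/-- A code relates every occupied position to itself, so its diagonal records the number of
vertices. -/
lemma IsCodeOf.diag_iff [Finite V] {G : SimpleGraph V} {M : V → Prop} {B : Code V}
    (h : IsCodeOf G M B) (p : Num V) : B p p ↔ (p : ℕ) < {y | M y}.ncard := by
  obtain ⟨π, hinj, hlt, h⟩ := h
  rw [h]
  constructor
  · rintro ⟨x, _, hx, _, h, _⟩
    rw [← h]
    exact hlt x hx
  · intro hp
    obtain ⟨x, hx, hxp⟩ := exists_eq_of_injective_of_lt hinj hlt hp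
    exact ⟨x, x, hx, hx, hxp, hxp, .inl rfl⟩

lemma ncard_lt_num [Finite V] (X : Set V) : X.ncard < Nat.card V + 1 :=
  Nat.lt_succ_of_le ((Set.ncard_le_ncard (Set.subset_univ X)).trans (by rw [Set.ncard_univ]))

lemma IsCodeOf.ncard_eq [Finite V] {G : SimpleGraph V} {M M' : V → Prop} {B B' : Code V}
    (h : IsCodeOf G M B) (h' : IsCodeOf G M' B') (hB : ∀ i i', B i i' ↔ B' i i') :
    {y | M y}.ncard = {y | M' y}.ncard := by
  have key : ∀ k < Nat.card V + 1, (k < {y | M y}.ncard ↔ k < {y | M' y}.ncard) := fun k hk => by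
    rw [← h.diag_iff ⟨k, hk⟩, ← h'.diag_iff ⟨k, hk⟩, hB]
  have h₁ := key _ (ncard_lt_num {y | M y})
  have h₂ := key _ (ncard_lt_num {y | M' y})
  omega

/-! ### Concatenating codes along a preorder with ties -/

section Concat

variable {G : SimpleGraph V} {M : V → Prop} {s : V → V → Prop} {A : V → Code V}
  {P : V → V → Prop}

/-- Equivalent vertices have the same offset. -/
lemma IsGoodOrder.counts_eq (hP : IsGoodOrder G M s A P) {x y : V} (hx : M x) (hy : M y)
    (hxy : P x y) (hyx : P y x) :
    lowerCount M P x = lowerCount M P y ∧ upperCount M P x = upperCount M P y := by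
  obtain ⟨-, htr, -⟩ := hP
  constructor
  · unfold lowerCount
    congr 1
    ext z
    constructor
    · rintro ⟨hz, h, h'⟩
      exact ⟨hz, htr z x y hz hx hy h hxy, fun h'' => h' (htr x y z hx hy hz hxy h'')⟩
    · rintro ⟨hz, h, h'⟩
      exact ⟨hz, htr z y x hz hy hx h hyx, fun h'' => h' (htr y x z hy hx hz hyx h'')⟩
  · unfold upperCount
    congr 1
    ext z
    exact ⟨fun h => ⟨h.1, htr z x y h.1 hx hy h.2 hxy⟩,
      fun h => ⟨h.1, htr z y x h.1 hy hx h.2 hyx⟩⟩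

variable [Finite V]

/-- Everything up to `x`, ties included, is strictly below `y`; hence the position intervals of
different tie classes are disjoint. -/
lemma IsGoodOrder.upper_le_lower (hP : IsGoodOrder G M s A P) {x y : V} (hx : M x) (hy : M y)
    (hyx : ¬ P y x) : upperCount M P x ≤ lowerCount M P y := by
  obtain ⟨htot, htr, -⟩ := hP
  have hxy := (htot x y hx hy).resolve_right hyx
  refine Set.ncard_le_ncard ?_ (Set.toFinite _)
  rintro z ⟨hz, hzx⟩
  exact ⟨hz, htr z x y hz hx hy hzx hxy, fun h => hyx (htr y z x hy hz hx h hzx)⟩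

lemma IsGoodOrder.equiv_of_mem (hP : IsGoodOrder G M s A P) {x y : V} (hx : M x) (hy : M y)
    {p : ℕ} (h₁ : lowerCount M P x ≤ p) (h₂ : p < upperCount M P x) (h₃ : lowerCount M P y ≤ p)
    (h₄ : p < upperCount M P y) : P x y ∧ P y x := by
  constructor
  · by_contra h
    have := hP.upper_le_lower hy hx h
    omega
  · by_contra h
    have := hP.upper_le_lower hx hy h
    omega

lemma IsGoodOrder.classSize_eq (hP : IsGoodOrder G M s A P)
    (hA : ∀ x, M x → IsCodeOf G (s x) (A x)) {x y : V} (hx : M x) (hy : M y) (hxy : P x y)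
    (hyx : P y x) : classSize s x = classSize s y :=
  (hA x hx).ncard_eq (hA y hy) (hP.2.2.2.1 x y hx hy hxy hyx)

lemma eq_and_eq_of_mul_add {j j' i i' m : ℕ} (hi : i < m) (hi' : i' < m)
    (h : j * m + i = j' * m + i') : j = j' ∧ i = i' := by
  have hm : 0 < m := by omega
  have h₁ : (j * m + i) / m = j := by
    rw [mul_comm, Nat.mul_add_div hm, Nat.div_eq_of_lt hi, add_zero]
  have h₂ : (j' * m + i') / m = j' := by
    rw [mul_comm, Nat.mul_add_div hm, Nat.div_eq_of_lt hi', add_zero]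
  have hj : j = j' := by rw [← h₁, h, h₂]
  subst hj
  exact ⟨rfl, by omega⟩

/-- A position determines the class of `P`, the index and the inner position. -/
lemma IsGoodOrder.decode (hP : IsGoodOrder G M s A P) (hA : ∀ x, M x → IsCodeOf G (s x) (A x))
    {x y : V} (hx : M x) (hy : M y) {j i j' i' p : ℕ}
    (h₁ : p = lowerCount M P x + j * classSize s x + i) (h₂ : i < classSize s x)
    (h₃ : p < upperCount M P x) (h₁' : p = lowerCount M P y + j' * classSize s y + i')
    (h₂' : i' < classSize s y) (h₃' : p < upperCount M P y) :
    P x y ∧ P y x ∧ j = j' ∧ i = i' := by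
  obtain ⟨hxy, hyx⟩ := hP.equiv_of_mem hx hy (by omega) h₃ (by omega) h₃'
  have hc := (hP.counts_eq hx hy hxy hyx).1
  have hs := hP.classSize_eq hA hx hy hxy hyx
  rw [← hs] at h₁' h₂'
  exact ⟨hxy, hyx, eq_and_eq_of_mul_add h₂ h₂' (by omega)⟩

/-- An arbitrary numbering of the classes breaks the ties and gives an actual enumeration `pos`. The
code does not depend on it, since tied classes have equal codes and the same adjacencies to other
classes; any vertex tied with the one at a position can therefore stand in for it. -/
theorem IsGoodOrder.isCodeOf_concat (hP : IsGoodOrder G M s A P) (hs : Equivalence s)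
    (hsM : ∀ {x y}, s x y → M x → M y) (hA : ∀ x, M x → IsCodeOf G (s x) (A x))
    (hAs : ∀ {x y}, s x y → A x = A y) : IsCodeOf G M (concat G M s A P) := by
  classical
  obtain ⟨htot, htr, hsP, hPA, hhom⟩ := id hP
  let S : Setoid V := ⟨s, hs⟩
  let rep : V → V := fun x => (Quotient.mk S x).out
  have hrep : ∀ x, s x (rep x) := fun x => hs.symm (Quotient.mk_out (s := S) x)
  have hrep' : ∀ {x y}, s x y → rep x = rep y := fun {x y} hxy => by
    have : Quotient.mk S x = Quotient.mk S y := Quotient.sound hxy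
    simp only [rep, this]
  let μ : V → ℕ := fun x => (Finite.equivFin V (rep x) : ℕ)
  have hμ : ∀ {x y}, μ x = μ y ↔ s x y := by
    intro x y
    constructor
    · intro h
      have h' : rep x = rep y := (Finite.equivFin V).injective (Fin.ext h)
      exact hs.trans (hrep x) (h' ▸ hs.symm (hrep y))
    · intro h
      simp only [μ, hrep' h]
  have hexists : ∀ x, ∃ π : V → ℕ, M x → (∀ y z, s x y → s x z → π y = π z → y = z) ∧
      (∀ y, s x y → π y < classSize s x) ∧
      ∀ p q : Num V, A x p q ↔ ∃ y z, s x y ∧ s x z ∧ π y = p ∧ π z = q ∧ (y = z ∨ G.Adj y z) := by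
    intro x
    by_cases hx : M x
    · obtain ⟨π, hπ⟩ := hA x hx
      exact ⟨π, fun _ => hπ⟩
    · exact ⟨fun _ => 0, fun h => absurd h hx⟩
  choose inner hinner using hexists
  let π : V → ℕ := fun x => inner (rep x) x
  -- Representatives of the classes tied with that of `x` and numbered before it. Their number `idx
  -- x` becomes the index `j` of `PlacedAt`.
  let R : V → Set V := fun x => {z | rep z = z ∧ M z ∧ P z x ∧ P x z ∧ μ z < μ x}
  let idx : V → ℕ := fun x => (R x).ncard
  have hrepM : ∀ {x}, M x → M (rep x) := fun hx => hsM (hrep _) hx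
  have hμrep : ∀ x, μ (rep x) = μ x := fun x => hμ.2 (hs.symm (hrep x))
  have hPr : ∀ {x}, M x → P x (rep x) ∧ P (rep x) x := fun {x} hx =>
    ⟨hsP _ _ hx (hrepM hx) (hrep x), hsP _ _ (hrepM hx) hx (hs.symm (hrep x))⟩
  have hrr : ∀ x, rep (rep x) = rep x := fun x => (hrep' (hrep x)).symm
  have hins : ∀ {x}, M x → (insert (rep x) (R x)).ncard = idx x + 1 := fun {x} hx => by
    refine Set.ncard_insert_of_notMem ?_ (Set.toFinite _)
    rintro ⟨-, -, -, -, h⟩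
    exact h.ne (hμrep x)
  have hidxlt : ∀ {x y}, M x → M y → P x y → P y x → μ x < μ y → idx x < idx y := by
    intro x y hx hy hxy hyx hlt
    have : (insert (rep x) (R x)).ncard ≤ (R y).ncard := by
      refine Set.ncard_le_ncard ?_ (Set.toFinite _)
      rintro z (rfl | ⟨h₁, h₂, h₃, h₄, h₅⟩)
      · exact ⟨hrr x, hrepM hx, htr _ _ _ (hrepM hx) hx hy (hPr hx).2 hxy,
          htr _ _ _ hy hx (hrepM hx) hyx (hPr hx).1, by rwa [hμrep]⟩
      · exact ⟨h₁, h₂, htr _ _ _ h₂ hx hy h₃ hxy, htr _ _ _ hy hx h₂ hyx h₄, h₅.trans hlt⟩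
    rw [hins hx] at this
    exact this
  have hidx : ∀ {x y}, M x → M y → P x y → P y x → idx x = idx y → s x y := by
    intro x y hx hy hxy hyx h
    rcases lt_trichotomy (μ x) (μ y) with h' | h' | h'
    · exact absurd h (hidxlt hx hy hxy hyx h').ne
    · exact hμ.1 h'
    · exact absurd h.symm (hidxlt hy hx hyx hxy h').ne
  have hidx' : ∀ {x y}, M x → M y → s x y → idx x = idx y := by
    intro x y hx hy hxy
    have hP₁ := hsP _ _ hx hy hxy
    have hP₂ := hsP _ _ hy hx (hs.symm hxy)
    have : R x = R y := by
      ext z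
      have hm := hμ.2 hxy
      constructor
      · rintro ⟨h₁, h₂, h₃, h₄, h₅⟩
        exact ⟨h₁, h₂, htr _ _ _ h₂ hx hy h₃ hP₁, htr _ _ _ hy hx h₂ hP₂ h₄, hm ▸ h₅⟩
      · rintro ⟨h₁, h₂, h₃, h₄, h₅⟩
        exact ⟨h₁, h₂, htr _ _ _ h₂ hy hx h₃ hP₂, htr _ _ _ hx hy h₂ hP₁ h₄, hm ▸ h₅⟩
    simp only [idx, this]
  have hsize : ∀ {x y}, M x → M y → P x y → P y x → classSize s x = classSize s y :=
    hP.classSize_eq hA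
  -- The first `idx x + 1` classes tied with `x` are disjoint and of equal size, so their blocks fit
  -- between the two counts.
  have hblock : ∀ {x}, M x →
      lowerCount M P x + (idx x + 1) * classSize s x ≤ upperCount M P x := by
    intro x hx
    have hR : ∀ z ∈ insert (rep x) (R x), rep z = z ∧ M z ∧ P z x ∧ P x z := by
      rintro z (rfl | ⟨h₁, h₂, h₃, h₄, -⟩)
      · exact ⟨hrr x, hrepM hx, (hPr hx).2, (hPr hx).1⟩
      · exact ⟨h₁, h₂, h₃, h₄⟩
    have hfin : (insert (rep x) (R x)).Finite := Set.toFinite _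
    have hU : (⋃ z ∈ insert (rep x) (R x), {y | s z y}).ncard = (idx x + 1) * classSize s x := by
      have := Fintype.ofFinite V
      rw [← hins hx, Set.ncard_eq_toFinset_card _ hfin, ← smul_eq_mul, ← Finset.sum_const]
      have : (⋃ z ∈ insert (rep x) (R x), {y | s z y}) =
          (hfin.toFinset.biUnion fun z => {y | s z y}.toFinset : Finset V) := by
        ext y
        simp
      rw [this, Set.ncard_coe_finset, Finset.card_biUnion]
      · refine Finset.sum_congr rfl fun z hz => ?_
        obtain ⟨-, h₂, h₃, h₄⟩ := hR z (hfin.mem_toFinset.1 hz)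
        rw [← Set.ncard_eq_toFinset_card']
        exact hsize h₂ hx h₃ h₄
      · intro z hz z' hz' hne
        refine Finset.disjoint_left.2 fun y hy hy' => ?_
        simp only [Set.mem_toFinset, Set.mem_ofPred_eq] at hy hy'
        have := hrep' (hs.trans hy (hs.symm hy'))
        rw [(hR z (hfin.mem_toFinset.1 hz)).1, (hR z' (hfin.mem_toFinset.1 hz')).1] at this
        exact hne this
    have hmem : ∀ y ∈ ⋃ z ∈ insert (rep x) (R x), {y | s z y}, M y ∧ P y x ∧ P x y := by
      intro y hy
      simp only [Set.mem_iUnion] at hy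
      obtain ⟨z, hz, hzy⟩ := hy
      obtain ⟨-, h₂, h₃, h₄⟩ := hR z hz
      have hy := hsM hzy h₂
      exact ⟨hy, htr _ _ _ hy h₂ hx (hsP _ _ hy h₂ (hs.symm hzy)) h₃,
        htr _ _ _ hx h₂ hy h₄ (hsP _ _ h₂ hy hzy)⟩
    rw [← hU, lowerCount, ← Set.ncard_union_eq ?_ (Set.toFinite _) (Set.toFinite _)]
    · refine Set.ncard_le_ncard ?_ (Set.toFinite _)
      rintro y (hy | hy)
      · exact ⟨hy.1, hy.2.1⟩
      · exact ⟨(hmem y hy).1, (hmem y hy).2.1⟩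
    · rw [Set.disjoint_left]
      intro y hy hy'
      exact hy.2.2 (hmem y hy').2.2
  have hupper : ∀ x, upperCount M P x ≤ {y | M y}.ncard := fun x =>
    Set.ncard_le_ncard (fun y hy => hy.1) (Set.toFinite _)
  have hπ : ∀ {x}, M x → π x < classSize s x := fun {x} hx => by
    have := (hinner (rep x) (hrepM hx)).2.1 x (hs.symm (hrep x))
    rwa [hsize (hrepM hx) hx (hPr hx).2 (hPr hx).1] at this
  let pos : V → ℕ := fun x => lowerCount M P x + idx x * classSize s x + π x
  have hpos : ∀ {x}, M x → pos x < upperCount M P x := fun {x} hx => by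
    have h₁ := hblock hx
    have h₂ := hπ hx
    simp only [pos]
    rw [add_mul, one_mul] at h₁
    omega
  have hAx : ∀ {x y p q}, M x → s x y → (A x p q ↔ ∃ y z, s x y ∧ s x z ∧ π y = (p : ℕ) ∧
      π z = (q : ℕ) ∧ (y = z ∨ G.Adj y z)) := by
    intro x y p q hx hxy
    rw [hAs (hrep x), (hinner (rep x) (hrepM hx)).2.2 p q]
    have hr : ∀ y, s (rep x) y ↔ s x y := fun y =>
      ⟨fun h => hs.trans (hrep x) h, fun h => hs.trans (hs.symm (hrep x)) h⟩
    refine exists_congr fun y => exists_congr fun z => ?_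
    rw [hr, hr]
    refine and_congr_right fun hy => and_congr_right fun hz => ?_
    simp only [π, ← hrep' hy, ← hrep' hz]
  have hπinj : ∀ {x y}, M x → s x y → π x = π y → x = y := by
    intro x y hx hxy h
    refine (hinner (rep x) (hrepM hx)).1 x y (hs.symm (hrep x))
      (hs.trans (hs.symm (hrep x)) hxy) ?_
    simpa only [π, ← hrep' hxy] using h
  have hnum : ∀ {k}, k ≤ {y | M y}.ncard → k < Nat.card V + 1 := fun h =>
    h.trans_lt (ncard_lt_num _)
  have hplaced : ∀ {x} (hx : M x) {p : Num V}, pos x = p →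
      ∃ j i : Num V, PlacedAt M s P x j i p ∧ (j : ℕ) = idx x ∧ (i : ℕ) = π x := by
    intro x hx p hp
    have h₁ := hπ hx
    have h₂ := (hpos hx).le.trans (hupper x)
    have h₃ : idx x * 1 ≤ idx x * classSize s x := Nat.mul_le_mul_left _ (by omega)
    simp only [pos] at h₂
    refine ⟨⟨idx x, hnum (by omega)⟩, ⟨π x, hnum (by omega)⟩, ⟨hp.symm, hπ hx, ?_⟩, rfl, rfl⟩
    rw [← hp]
    exact hpos hx
  refine ⟨pos, fun x y hx hy hxy => ?_, fun x hx => (hpos hx).trans_le (hupper x),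
    fun p q => ⟨?_, ?_⟩⟩
  · obtain ⟨h₁, h₂, h₃, h₄⟩ := hP.decode hA hx hy (p := pos x) rfl (hπ hx) (hpos hx) hxy (hπ hy)
      (hxy ▸ hpos hy)
    exact hπinj hx (hidx hx hy h₁ h₂ h₃) h₄
  -- The witnesses `x'` and `y'` need not sit at the positions `p` and `q`; `decode` shows that the
  -- vertices there are tied with them and have the indices `j` and `j'`.
  · rintro ⟨x', y', ⟨hx', hy'⟩, j, j', i, i', hp, hq, h⟩
    have hsurj : ∀ k < {y | M y}.ncard, ∃ x, M x ∧ pos x = k := by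
      intro k hk
      refine exists_eq_of_injective_of_lt (fun x y hx hy hxy => ?_)
        (fun x hx => (hpos hx).trans_le (hupper x)) hk
      obtain ⟨h₁, h₂, h₃, h₄⟩ := hP.decode hA hx hy (p := pos x) rfl (hπ hx) (hpos hx) hxy
        (hπ hy) (hxy ▸ hpos hy)
      exact hπinj hx (hidx hx hy h₁ h₂ h₃) h₄
    obtain ⟨x, hx, hxp⟩ := hsurj p (hp.2.2.trans_le (hupper x'))
    obtain ⟨y, hy, hyq⟩ := hsurj q (hq.2.2.trans_le (hupper y'))
    obtain ⟨hx₁, hx₂, hxj, hxi⟩ := hP.decode hA hx hx' (p := pos x) rfl (hπ hx) (hpos hx)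
      (hxp.trans hp.1) hp.2.1 (hxp ▸ hp.2.2)
    obtain ⟨hy₁, hy₂, hyj, hyi⟩ := hP.decode hA hy hy' (p := pos y) rfl (hπ hy) (hpos hy)
      (hyq.trans hq.1) hq.2.1 (hyq ▸ hq.2.2)
    refine ⟨x, y, hx, hy, hxp, hyq, ?_⟩
    rcases h with ⟨hs', hjj, hA'⟩ | ⟨hs', hadj, hjj⟩
    · have hxy₁ : P x y := htr _ _ _ hx hx' hy hx₁
        (htr _ _ _ hx' hy' hy (hsP _ _ hx' hy' hs') hy₂)
      have hxy₂ : P y x := htr _ _ _ hy hy' hx hy₁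
        (htr _ _ _ hy' hx' hx (hsP _ _ hy' hx' (hs.symm hs')) hx₂)
      have hsxy : s x y := hidx hx hy hxy₁ hxy₂ (by rw [hxj, hjj, hyj])
      rw [← hPA x x' hx hx' hx₁ hx₂, hAx hx hsxy] at hA'
      obtain ⟨a, b, ha, hb, hap, hbq, hab⟩ := hA'
      have hxa : x = a := hπinj hx ha (by rw [hxi, hap])
      have hyb : y = b := hπinj hy (hs.trans (hs.symm hsxy) hb) (by rw [hyi, hbq])
      rwa [hxa, hyb]
    · right
      -- If `x` and `y` were in one class, then `x'` and `y'` would be tied with equal indices,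
      -- which `concat` excludes.
      have hsxy : ¬ s x y := by
        intro hsxy
        have h₁ : P x' y' := htr _ _ _ hx' hx hy' hx₂
          (htr _ _ _ hx hy hy' (hsP _ _ hx hy hsxy) hy₁)
        have h₂ : P y' x' := htr _ _ _ hy' hy hx' hy₂
          (htr _ _ _ hy hx hx' (hsP _ _ hy hx (hs.symm hsxy)) hx₁)
        refine hjj h₁ h₂ (Fin.ext ?_)
        rw [← hxj, ← hyj]
        exact hidx' hx hy hsxy
      exact (hhom x y x' y' hx hy hx' hy' hsxy hs' hx₁ hx₂ hy₁ hy₂).2 hadj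
  · rintro ⟨x, y, hx, hy, hxp, hyq, h⟩
    obtain ⟨j, i, hp, hj, hi⟩ := hplaced hx hxp
    obtain ⟨j', i', hq, hj', hi'⟩ := hplaced hy hyq
    refine ⟨x, y, ⟨hx, hy⟩, j, j', i, i', hp, hq, ?_⟩
    by_cases hsxy : s x y
    · refine .inl ⟨hsxy, Fin.ext (by rw [hj, hj', hidx' hx hy hsxy]), ?_⟩
      rw [hAx hx hsxy]
      exact ⟨x, y, hs.refl x, hsxy, hi.symm, hi'.symm, h⟩
    · refine .inr ⟨hsxy, h.resolve_left fun h' => hsxy (h' ▸ hs.refl x), fun h₁ h₂ h₃ => ?_⟩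
      exact hsxy (hidx hx hy h₁ h₂ (by rw [← hj, ← hj', h₃]))

end Concat

/-! ### The canonical code of a class -/

section CanonStep

/-- The quotient of `M` by `s` is empty or complete. -/
def IsHomogeneous (G : SimpleGraph V) (M : V → Prop) (s : V → V → Prop) : Prop :=
  (∀ x y, M x → M y → ¬ s x y → ¬ G.Adj x y) ∨ (∀ x y, M x → M y → ¬ s x y → G.Adj x y)

/-- The preorder of the classes of `s` in `M` for the start vertex `w`. -/
def candidate (G : SimpleGraph V) (M : V → Prop) (s : V → V → Prop) (A : V → Code V) (w : V)
    (x y : V) : Prop :=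
  (IsHomogeneous G M s ∧ CodeLE (A x) (A y)) ∨
    (¬ IsHomogeneous G M s ∧ (s x y ∨ Rec G M s w true x y))

/-- The least code of `M` that arises from the codes `A` of the classes of `s`. -/
def canonStep (G : SimpleGraph V) (M : V → Prop) (s : V → V → Prop) (A : V → Code V) :
    Code V := fun p q =>
  ∃ w, M w ∧ IsGoodOrder G M s A (candidate G M s A w) ∧
    (∀ w', M w' → IsGoodOrder G M s A (candidate G M s A w') →
      CodeLE (concat G M s A (candidate G M s A w)) (concat G M s A (candidate G M s A w'))) ∧
    concat G M s A (candidate G M s A w) p q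

/-- The canonical codes of the classes of level `|V| - e`. -/
def canonCode (G : SimpleGraph V) : ℕ → V → Code V
  | 0 => fun _ p q => (p : ℕ) = 0 ∧ (q : ℕ) = 0
  | e + 1 => fun v p q => canonStep G (level G (Nat.card V - (e + 1)) v)
      (level G (Nat.card V - e)) (canonCode G e) p q ∨ ((p : ℕ) = 0 ∧ (q : ℕ) = 0)

/-- This gives the non-empty levels that `definable_numRec` requires, for every graph. -/
lemma canonCode_zero (G : SimpleGraph V) (e : ℕ) (v : V) : canonCode G e v 0 0 := by
  cases e with
  | zero => exact ⟨rfl, rfl⟩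
  | succ e => exact .inr ⟨rfl, rfl⟩

variable [Finite V] {G : SimpleGraph V} {M : V → Prop} {s : V → V → Prop} {A : V → Code V}

/-- By antisymmetry all minimizing start vertices give the same code, so their union in `canonStep`
is that code and nothing is chosen. -/
lemma exists_canonStep_eq (h : ∃ w, M w ∧ IsGoodOrder G M s A (candidate G M s A w)) :
    ∃ w, M w ∧ IsGoodOrder G M s A (candidate G M s A w) ∧
      canonStep G M s A = concat G M s A (candidate G M s A w) := by
  obtain ⟨w, ⟨hw, hgood⟩, hmin⟩ := Set.exists_min_image
    {w | M w ∧ IsGoodOrder G M s A (candidate G M s A w)}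
    (fun w => (concat G M s A (candidate G M s A w)).lex) (Set.toFinite _) h
  refine ⟨w, hw, hgood, ?_⟩
  have hmin' : ∀ w', M w' → IsGoodOrder G M s A (candidate G M s A w') →
      CodeLE (concat G M s A (candidate G M s A w)) (concat G M s A (candidate G M s A w')) :=
    fun w' h₁ h₂ => codeLE_iff.2 (hmin w' ⟨h₁, h₂⟩)
  funext p q
  refine propext ⟨?_, fun h => ⟨w, hw, hgood, hmin', h⟩⟩
  rintro ⟨w', hw', hgood', hmin'', h⟩
  rwa [(hmin' w' hw' hgood').antisymm (hmin'' w hw hgood)]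

/-- In an edgeless or complete quotient, sorting by code ties only classes with identical codes, and
adjacency between classes is constant. In a prime quotient some start vertex orders the classes
linearly, so ties occur only within a class. -/
lemma exists_isGoodOrder {lt₁ lt₂ : V → V → Prop} (hG : IsRealizer G lt₁ lt₂)
    (hs : Equivalence s) (hsM : ∀ {x y}, s x y → M x → M y)
    (hmod : ∀ {x y z}, M x → M y → M z → s x y → ¬ s x z → (G.Adj z x ↔ G.Adj z y))
    (htri : IsHomogeneous G M s ∨
      ∀ X : Set V, IsModuleIn G {x | M x} X → X ≠ {x | M x} → ∀ x ∈ X, ∀ y ∈ X, s x y)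
    (hAs : ∀ {x y}, s x y → A x = A y) {u : V} (hu : M u) :
    ∃ w, M w ∧ IsGoodOrder G M s A (candidate G M s A w) := by
  by_cases hhom : IsHomogeneous G M s
  · have hc : ∀ x y, candidate G M s A u x y ↔ (A x).lex ≤ (A y).lex := fun x y => by
      rw [candidate, ← codeLE_iff]
      simp [hhom]
    refine ⟨u, hu, ?_⟩
    simp only [IsGoodOrder, hc]
    refine ⟨fun _ _ _ _ => le_total _ _, fun _ _ _ _ _ _ => le_trans,
      fun x y _ _ h => (hAs h ▸ le_rfl), fun x y _ _ h h' i i' => ?_, ?_⟩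
    · rw [Code.lex_injective (le_antisymm h h')]
    · intro x y x' y' hx hy hx' hy' h h' _ _ _ _
      rcases hhom with hhom | hhom
      · simp [hhom x y hx hy h, hhom x' y' hx' hy' h']
      · simp [hhom x y hx hy h, hhom x' y' hx' hy' h']
  · obtain ⟨w, rep, hw, hrep, hrec⟩ := exists_rec_iff hG hs hsM hmod (htri.resolve_left hhom) hu
    have := hG.1
    have hc : ∀ x y, M x → M y →
        (candidate G M s A w x y ↔ rep x = rep y ∨ lt₁ (rep x) (rep y)) := fun x y hx hy => by
      rw [candidate, hrec x y hx hy, hrep]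
      simp [hhom]
    have hanti : ∀ x y, M x → M y → candidate G M s A w x y → candidate G M s A w y x → s x y := by
      intro x y hx hy h h'
      rw [hc _ _ hx hy] at h
      rw [hc _ _ hy hx] at h'
      rw [← hrep]
      rcases h with h | h
      · exact h
      · rcases h' with h' | h'
        · exact h'.symm
        · exact absurd h' (hG.asymm₁ h)
    refine ⟨w, hw, fun x y hx hy => ?_, fun x y z hx hy hz h h' => ?_, fun x y hx hy h => ?_,
      fun x y hx hy h h' i i' => ?_, fun x y x' y' hx hy hx' hy' h h' h₁ h₂ h₃ h₄ => ?_⟩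
    · rw [hc x y hx hy, hc y x hy hx]
      rcases trichotomous_of lt₁ (rep x) (rep y) with h | h | h
      · exact .inl (.inr h)
      · exact .inl (.inl h)
      · exact .inr (.inr h)
    · rw [hc _ _ hx hy] at h
      rw [hc _ _ hy hz] at h'
      rw [hc _ _ hx hz]
      rcases h with h | h <;> rcases h' with h' | h'
      · exact .inl (h.trans h')
      · exact .inr (h ▸ h')
      · exact .inr (h' ▸ h)
      · exact .inr (trans_of lt₁ h h')
    · exact (hc x y hx hy).2 (.inl ((hrep x y).2 h))
    · rw [hAs (hanti x y hx hy h h')]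
    · have hx' := hanti x x' hx hx' h₁ h₂
      have hy' := hanti y y' hy hy' h₃ h₄
      -- Replace `x` by `x'` as seen from `y`, then `y` by `y'` as seen from `x'`; each step stays
      -- inside one module.
      have hyx : ¬ s y x' := fun h'' => h (hs.trans hx' (hs.symm h''))
      rw [G.adj_comm, hmod hx (by assumption) hy hx' h, G.adj_comm,
        hmod hy (by assumption) (by assumption) hy' hyx]

theorem isCodeOf_canonStep {lt₁ lt₂ : V → V → Prop} (hG : IsRealizer G lt₁ lt₂)
    (hs : Equivalence s) (hsM : ∀ {x y}, s x y → M x → M y)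
    (hmod : ∀ {x y z}, M x → M y → M z → s x y → ¬ s x z → (G.Adj z x ↔ G.Adj z y))
    (htri : IsHomogeneous G M s ∨
      ∀ X : Set V, IsModuleIn G {x | M x} X → X ≠ {x | M x} → ∀ x ∈ X, ∀ y ∈ X, s x y)
    (hAs : ∀ {x y}, s x y → A x = A y) (hA : ∀ x, M x → IsCodeOf G (s x) (A x)) {u : V}
    (hu : M u) : IsCodeOf G M (canonStep G M s A) := by
  obtain ⟨w, -, hgood, heq⟩ := exists_canonStep_eq (exists_isGoodOrder hG hs hsM hmod htri hAs hu)
  rw [heq]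
  exact hgood.isCodeOf_concat hs hsM hA hAs

/-- A non-empty module already occupies position 0, so the pair added in `canonCode` changes
nothing. -/
lemma IsCodeOf.or_zero {B : Code V} (h : IsCodeOf G M B) {u : V} (hu : M u) :
    IsCodeOf G M fun p q => B p q ∨ ((p : ℕ) = 0 ∧ (q : ℕ) = 0) := by
  have h0 := (h.diag_iff 0).2 ((Set.ncard_pos (Set.toFinite _)).2 ⟨u, hu⟩)
  convert h using 1
  funext p q
  refine propext ⟨?_, .inl⟩
  rintro (h' | ⟨hp, hq⟩)
  · exact h'
  · rwa [show p = 0 from Fin.ext hp, show q = 0 from Fin.ext hq]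

/-- Constancy of the codes on classes is carried along because the next concatenation needs it. -/
theorem isCodeOf_canonCode {lt₁ lt₂ : V → V → Prop} (hG : IsRealizer G lt₁ lt₂) (e : ℕ)
    (he : e ≤ Nat.card V) :
    (∀ v, IsCodeOf G (level G (Nat.card V - e) v) (canonCode G e v)) ∧
      ∀ u v, level G (Nat.card V - e) u v → canonCode G e u = canonCode G e v := by
  induction e with
  | zero =>
    refine ⟨fun v => ⟨fun _ => 0, ?_, ?_, ?_⟩, fun _ _ _ => rfl⟩
    · intro x y hx hy _
      rw [Nat.sub_zero, level_card_iff] at hx hy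
      exact hx.symm.trans hy
    · intro x hx
      exact (Set.ncard_pos (Set.toFinite _)).2 ⟨x, hx⟩
    · intro p q
      constructor
      · rintro ⟨hp, hq⟩
        have := (equivalence_level G (Nat.card V - 0)).refl v
        exact ⟨v, v, this, this, hp.symm, hq.symm, .inl rfl⟩
      · rintro ⟨_, _, _, _, hp, hq, _⟩
        exact ⟨hp.symm, hq.symm⟩
  | succ e ih =>
    obtain ⟨ih₁, ih₂⟩ := ih (by omega)
    have hd : Nat.card V - e = Nat.card V - (e + 1) + 1 := by omega
    have hr := equivalence_level G (Nat.card V - (e + 1))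
    constructor
    · intro v
      have hs := equivalence_level G (Nat.card V - e)
      refine (isCodeOf_canonStep hG hs ?_ ?_ ?_ (fun h => ih₂ _ _ h) (fun x _ => ih₁ x)
        (hr.refl v)).or_zero (hr.refl v)
      · intro x y hxy hx
        rw [hd] at hxy
        exact hr.trans hx hxy.1
      · intro x y z hx _ hz hxy hxz
        rw [hd] at hxy hxz
        exact split_adj_iff hr hxy (hr.trans (hr.symm hx) hz) hxz
      · rw [hd]
        rcases split_trichotomy (G := G) hr v with h | h | h
        · exact .inl (.inl h)
        · exact .inl (.inr h)
        · exact .inr h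
    · intro u v huv
      have : level G (Nat.card V - (e + 1)) u = level G (Nat.card V - (e + 1)) v := by
        funext x
        exact propext ⟨fun h => hr.trans (hr.symm huv) h, fun h => hr.trans huv h⟩
      simp only [canonCode, this]

end CanonStep
end Codes
end FPC

namespace FPC

/-! ### Definable queries -/

section Definability

open FirstOrder

/-- Families of objects that depend on a graph and on assignments of the variables. -/
abbrev Query (α β : Type) (Δ : List (ℕ × ℕ)) (T : Type → Type) : Type 1 :=
  ∀ U : Type, SimpleGraph U → (α → U) → (β → Num U) → RelAssignment U Δ → T U

/-- The query `Q` is defined by a formula, which belongs to `FP` if `fp` holds. -/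
def Definable (fp : Prop) {α β : Type} {Δ : List (ℕ × ℕ)} (Q : Query α β Δ fun _ => Prop) : Prop :=
  ∃ φ : Formula Language.graph α β Δ, (fp → φ.IsFP) ∧
    ∀ (U : Type) [Finite U] [Nonempty U] (G : SimpleGraph U) (x : α → U) (n : β → Num U)
      (ρ : RelAssignment U Δ), φ.Sat G.structure x n ρ ↔ Q U G x n ρ

/-- Renamings of relational variables. -/
abbrev RVarMap (Δ Δ' : List (ℕ × ℕ)) : Type := ∀ k l : ℕ, RVar Δ k l → RVar Δ' k l

/-- The unary relation `M` is definable in every extension of the context. -/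
structure Definable₁ (fp : Prop) {α β : Type} {Δ : List (ℕ × ℕ)}
    (M : Query α β Δ fun U => U → Prop) : Prop where
  app : ∀ {α' β' : Type} {Δ' : List (ℕ × ℕ)} (f : α → α') (g : β → β') (h : RVarMap Δ Δ') (a : α'),
    Definable fp fun U G x n ρ => M U G (fun i => x (f i)) (fun i => n (g i))
      (fun k l X => ρ k l (h k l X)) (x a)

/-- The binary relation `R` is definable in every extension of the context. -/
structure Definable₂ (fp : Prop) {α β : Type} {Δ : List (ℕ × ℕ)}
    (R : Query α β Δ fun U => U → U → Prop) : Prop where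
  app : ∀ {α' β' : Type} {Δ' : List (ℕ × ℕ)} (f : α → α') (g : β → β') (h : RVarMap Δ Δ') (a b : α'),
    Definable fp fun U G x n ρ => R U G (fun i => x (f i)) (fun i => n (g i))
      (fun k l X => ρ k l (h k l X)) (x a) (x b)

/-- The code `B` is definable in every extension of the context. -/
structure DefinableCode (fp : Prop) {α β : Type} {Δ : List (ℕ × ℕ)}
    (B : Query α β Δ Code) : Prop where
  app : ∀ {α' β' : Type} {Δ' : List (ℕ × ℕ)} (f : α → α') (g : β → β') (h : RVarMap Δ Δ') (p q : β'),
    Definable fp fun U G x n ρ => B U G (fun i => x (f i)) (fun i => n (g i))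
      (fun k l X => ρ k l (h k l X)) (n p) (n q)

/-- The family `A` of codes is definable in every extension of the context. -/
structure DefinableCodes (fp : Prop) {α β : Type} {Δ : List (ℕ × ℕ)}
    (A : Query α β Δ fun U => U → Code U) : Prop where
  app : ∀ {α' β' : Type} {Δ' : List (ℕ × ℕ)} (f : α → α') (g : β → β') (h : RVarMap Δ Δ') (a : α')
    (p q : β'), Definable fp fun U G x n ρ => A U G (fun i => x (f i)) (fun i => n (g i))
      (fun k l X => ρ k l (h k l X)) (x a) (n p) (n q)

variable {fp : Prop} {α β : Type} {Δ : List (ℕ × ℕ)}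

/-! ### Closure under connectives, quantifiers, counting and arithmetic -/

namespace Definable

variable {Q Q' : Query α β Δ fun _ => Prop}

lemma congr (h : Definable fp Q)
    (hQ : ∀ (U : Type) [Finite U] [Nonempty U] (G : SimpleGraph U) (x : α → U) (n : β → Num U)
      (ρ : RelAssignment U Δ), Q' U G x n ρ ↔ Q U G x n ρ) : Definable fp Q' := by
  obtain ⟨φ, hφ, h⟩ := h
  exact ⟨φ, hφ, fun U _ _ G x n ρ => (h U G x n ρ).trans (hQ U G x n ρ).symm⟩

lemma falsum : Definable fp (fun _ _ _ _ _ => False : Query α β Δ fun _ => Prop) :=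
  ⟨.falsum, fun _ => trivial, fun _ _ _ _ _ _ _ => Iff.rfl⟩

lemma not (h : Definable fp Q) : Definable fp fun U G x n ρ => ¬ Q U G x n ρ := by
  obtain ⟨φ, hφ, h⟩ := h
  exact ⟨.neg φ, hφ, fun U _ _ G x n ρ => not_congr (h U G x n ρ)⟩

lemma and (h : Definable fp Q) (h' : Definable fp Q') :
    Definable fp fun U G x n ρ => Q U G x n ρ ∧ Q' U G x n ρ := by
  obtain ⟨φ, hφ, h⟩ := h
  obtain ⟨φ', hφ', h'⟩ := h'
  exact ⟨.and φ φ', fun hf => ⟨hφ hf, hφ' hf⟩,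
    fun U _ _ G x n ρ => and_congr (h U G x n ρ) (h' U G x n ρ)⟩

lemma verum : Definable fp (fun _ _ _ _ _ => True : Query α β Δ fun _ => Prop) :=
  falsum.not.congr fun _ _ _ _ _ _ _ => not_false_iff.symm

lemma or (h : Definable fp Q) (h' : Definable fp Q') :
    Definable fp fun U G x n ρ => Q U G x n ρ ∨ Q' U G x n ρ :=
  (h.not.and h'.not).not.congr fun _ _ _ _ _ _ _ => by tauto

lemma imp (h : Definable fp Q) (h' : Definable fp Q') :
    Definable fp fun U G x n ρ => Q U G x n ρ → Q' U G x n ρ :=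
  (h.not.or h').congr fun _ _ _ _ _ _ _ => by tauto

lemma iff (h : Definable fp Q) (h' : Definable fp Q') :
    Definable fp fun U G x n ρ => Q U G x n ρ ↔ Q' U G x n ρ :=
  ((h.imp h').and (h'.imp h)).congr fun _ _ _ _ _ _ _ => by tauto

lemma ex {Q : Query α β Δ fun U => U → Prop}
    (h : Definable fp (α := Option α)
      fun U G x n ρ => Q U G (fun a => x (some a)) n ρ (x none)) :
    Definable fp fun U G x n ρ => ∃ u, Q U G x n ρ u := by
  obtain ⟨φ, hφ, h⟩ := h
  exact ⟨.ex φ, hφ, fun U _ _ G x n ρ => exists_congr fun u => h U G (extend u x) n ρ⟩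

lemma all {Q : Query α β Δ fun U => U → Prop}
    (h : Definable fp (α := Option α)
      fun U G x n ρ => Q U G (fun a => x (some a)) n ρ (x none)) :
    Definable fp fun U G x n ρ => ∀ u, Q U G x n ρ u :=
  (ex (Q := fun U G x n ρ u => ¬ Q U G x n ρ u) h.not).not.congr fun _ _ _ _ _ _ _ => by
    rw [not_exists_not]

lemma exNum (hfp : ¬ fp) {Q : Query α β Δ fun U => Num U → Prop}
    (h : Definable fp (β := Option β)
      fun U G x n ρ => Q U G x (fun a => n (some a)) ρ (n none)) :
    Definable fp fun U G x n ρ => ∃ p, Q U G x n ρ p := by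
  obtain ⟨φ, hφ, h⟩ := h
  exact ⟨.exNum φ, fun h => absurd h hfp,
    fun U _ _ G x n ρ => exists_congr fun p => h U G x (extend p n) ρ⟩

lemma allNum (hfp : ¬ fp) {Q : Query α β Δ fun U => Num U → Prop}
    (h : Definable fp (β := Option β)
      fun U G x n ρ => Q U G x (fun a => n (some a)) ρ (n none)) :
    Definable fp fun U G x n ρ => ∀ p, Q U G x n ρ p :=
  (exNum hfp (Q := fun U G x n ρ u => ¬ Q U G x n ρ u) h.not).not.congr fun _ _ _ _ _ _ _ => by
    rw [not_exists_not]

lemma eq (a b : α) :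
    Definable fp (fun _ _ x _ _ => x a = x b : Query α β Δ fun _ => Prop) :=
  ⟨.eq a b, fun _ => trivial, fun _ _ _ _ _ _ _ => Iff.rfl⟩

lemma adj (a b : α) :
    Definable fp (fun _ G x _ _ => G.Adj (x a) (x b) : Query α β Δ fun _ => Prop) :=
  ⟨.rel Language.adj ![a, b], fun _ => trivial, fun _ _ _ _ _ _ _ => Iff.rfl⟩

lemma numLE (hfp : ¬ fp) (p q : β) :
    Definable fp (fun _ _ _ n _ => n p ≤ n q : Query α β Δ fun _ => Prop) :=
  ⟨.le p q, fun h => absurd h hfp, fun _ _ _ _ _ _ _ => Iff.rfl⟩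

lemma numLT (hfp : ¬ fp) (p q : β) :
    Definable fp (fun _ _ _ n _ => n p < n q : Query α β Δ fun _ => Prop) :=
  (numLE hfp q p).not.congr fun _ _ _ _ _ _ _ => not_le.symm

lemma numEq (hfp : ¬ fp) (p q : β) :
    Definable fp (fun _ _ _ n _ => n p = n q : Query α β Δ fun _ => Prop) :=
  ((numLE hfp p q).and (numLE hfp q p)).congr fun _ _ _ _ _ _ _ => le_antisymm_iff

lemma count (hfp : ¬ fp) {k l j : ℕ} {Q : Query α β Δ fun U => Tup U k l → Prop}
    (h : Definable fp (α := α ⊕ Fin k) (β := β ⊕ Fin l) fun U G x n ρ =>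
      Q U G (fun a => x (.inl a)) (fun a => n (.inl a)) ρ
        (fun i => x (.inr i), fun i => n (.inr i))) (p : Fin j → β) :
    Definable fp fun U G x n ρ => {t | Q U G x n ρ t}.ncard = numVal fun i => n (p i) := by
  obtain ⟨φ, hφ, h⟩ := h
  refine ⟨.count φ p, fun h => absurd h hfp, fun U _ _ G x n ρ => ?_⟩
  simp only [Formula.Sat]
  simp only [h, Sum.elim_inl, Sum.elim_inr]

/-- The empty tuple of number variables denotes 0, so existence is expressed as a non-zero count. -/
lemma exTup (hfp : ¬ fp) {k l : ℕ} {Q : Query α β Δ fun U => Tup U k l → Prop}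
    (h : Definable fp (α := α ⊕ Fin k) (β := β ⊕ Fin l) fun U G x n ρ =>
      Q U G (fun a => x (.inl a)) (fun a => n (.inl a)) ρ
        (fun i => x (.inr i), fun i => n (.inr i))) :
    Definable fp fun U G x n ρ => ∃ t, Q U G x n ρ t :=
  (h.count hfp (j := 0) Fin.elim0).not.congr fun U _ _ G x n ρ => by
    simp only [numVal, Finset.univ_eq_empty, Finset.sum_empty]
    rw [Set.ncard_eq_zero (Set.toFinite _)]
    exact Set.nonempty_iff_ne_empty

lemma countVertices (hfp : ¬ fp) {Q : Query α β Δ fun U => U → Prop}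
    (h : Definable fp (α := α ⊕ Fin 1) (β := β ⊕ Fin 0) fun U G x n ρ =>
      Q U G (fun a => x (.inl a)) (fun a => n (.inl a)) ρ (x (.inr 0))) (p : β) :
    Definable fp fun U G x n ρ => {u | Q U G x n ρ u}.ncard = (n p : ℕ) :=
  (count hfp (k := 1) (l := 0) (j := 1) (Q := fun U G x n ρ t => Q U G x n ρ (t.1 0)) h
    fun _ => p).congr fun U _ _ G x n ρ => by
      have hinj : Function.Injective fun u : U => ((fun _ => u, Fin.elim0) : Tup U 1 0) :=
        fun u v h => congrFun (congrArg Prod.fst h) 0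
      rw [← Set.ncard_image_of_injective _ hinj]
      have : (fun u : U => ((fun _ => u, Fin.elim0) : Tup U 1 0)) '' {u | Q U G x n ρ u} =
          {t | Q U G x n ρ (t.1 0)} := by
        ext t
        constructor
        · rintro ⟨u, hu, rfl⟩
          exact hu
        · intro ht
          refine ⟨t.1 0, ht, Prod.ext (funext fun i => ?_) (Subsingleton.elim _ _)⟩
          rw [Subsingleton.elim i 0]
      simp [this, numVal]

lemma countNums (hfp : ¬ fp) {Q : Query α β Δ fun U => Num U → Num U → Prop}
    (h : Definable fp (α := α ⊕ Fin 0) (β := β ⊕ Fin 2) fun U G x n ρ =>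
      Q U G (fun a => x (.inl a)) (fun a => n (.inl a)) ρ (n (.inr 0)) (n (.inr 1))) (p : β) :
    Definable fp fun U G x n ρ =>
      {z : Num U × Num U | Q U G x n ρ z.1 z.2}.ncard = (n p : ℕ) :=
  (count hfp (k := 0) (l := 2) (j := 1) (Q := fun U G x n ρ t => Q U G x n ρ (t.2 0) (t.2 1)) h
    fun _ => p).congr fun U _ _ G x n ρ => by
      have hinj : Function.Injective fun z : Num U × Num U =>
          ((Fin.elim0, ![z.1, z.2]) : Tup U 0 2) := fun u v h =>
        Prod.ext (congrFun (congrArg Prod.snd h) 0) (congrFun (congrArg Prod.snd h) 1)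
      rw [← Set.ncard_image_of_injective _ hinj]
      have : (fun z : Num U × Num U => ((Fin.elim0, ![z.1, z.2]) : Tup U 0 2)) ''
          {z | Q U G x n ρ z.1 z.2} = {t | Q U G x n ρ (t.2 0) (t.2 1)} := by
        ext t
        constructor
        · rintro ⟨z, hz, rfl⟩
          exact hz
        · intro ht
          refine ⟨(t.2 0, t.2 1), ht, Prod.ext (Subsingleton.elim _ _) (funext fun i => ?_)⟩
          fin_cases i <;> rfl
      simp [this, numVal]

lemma numZero (hfp : ¬ fp) (p : β) :
    Definable fp (fun _ _ _ n _ => (n p : ℕ) = 0 : Query α β Δ fun _ => Prop) :=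
  (allNum hfp (Q := fun _ _ _ n _ q => n p ≤ q) (numLE hfp _ _)).congr fun _ _ _ _ _ n _ => by
    constructor
    · intro h q
      rw [Fin.le_def, h]
      exact Nat.zero_le _
    · intro h
      exact Nat.le_zero.1 (h 0)

lemma numSucc (hfp : ¬ fp) (p q : β) :
    Definable fp (fun _ _ _ n _ => (n p : ℕ) + 1 = n q : Query α β Δ fun _ => Prop) :=
  ((numLT hfp p q).and (allNum hfp (Q := fun _ _ _ n _ r => ¬ (n p < r ∧ r < n q))
    ((numLT hfp _ _).and (numLT hfp _ _)).not)).congr fun U _ _ _ _ n _ => by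
    constructor
    · intro h
      refine ⟨Fin.lt_def.2 (by omega), fun r hr => ?_⟩
      rw [Fin.lt_def, Fin.lt_def] at hr
      omega
    · rintro ⟨h, h'⟩
      rw [Fin.lt_def] at h
      by_contra hne
      refine h' ⟨n p + 1, by omega⟩ ⟨Fin.lt_def.2 ?_, Fin.lt_def.2 ?_⟩ <;> simp only <;> omega

/-- A product is the number of pairs whose entries lie below the factors. -/
lemma numMul (hfp : ¬ fp) (p q r : β) :
    Definable fp (fun _ _ _ n _ => (n p : ℕ) * n q = n r : Query α β Δ fun _ => Prop) :=
  (countNums hfp (Q := fun _ _ _ n _ y z => y < n p ∧ z < n q)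
    ((numLT hfp _ _).and (numLT hfp _ _)) r).congr fun U _ _ _ _ n _ => by
    have : {z : Num U × Num U | z.1 < n p ∧ z.2 < n q} = Set.Iio (n p) ×ˢ Set.Iio (n q) := rfl
    rw [this, Set.ncard_prod]
    simp [Set.ncard_eq_toFinset_card']

lemma numAdd (hfp : ¬ fp) (p q r : β) :
    Definable fp (fun _ _ _ n _ => (n p : ℕ) + n q = n r : Query α β Δ fun _ => Prop) :=
  -- The first entry of a counted pair is pinned to `n p`, so the count is the length of the
  -- interval from `n p` to `n r`.
  ((numLE hfp p r).and (countNums hfp (Q := fun _ _ _ n _ y z => y = n p ∧ (y ≤ z ∧ z < n r))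
    ((numEq hfp _ _).and ((numLE hfp _ _).and (numLT hfp _ _))) q)).congr fun U _ _ _ _ n _ => by
    have : {z : Num U × Num U | z.1 = n p ∧ (z.1 ≤ z.2 ∧ z.2 < n r)} =
        {n p} ×ˢ Set.Ico (n p) (n r) := by
      ext ⟨y, z⟩
      constructor
      · rintro ⟨rfl, h⟩
        exact ⟨rfl, h⟩
      · rintro ⟨h, h'⟩
        obtain rfl : y = n p := h
        exact ⟨rfl, h'⟩
    rw [this, Set.ncard_prod, Set.ncard_singleton, one_mul, Fin.le_def]
    simp only [Set.ncard_eq_toFinset_card', Set.toFinset_Ico, Fin.card_Ico]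
    omega

lemma rvar {k l : ℕ} (X : RVar Δ k l) (hX : fp → l = 0) (a : Fin k → α) (p : Fin l → β) :
    Definable fp (fun _ _ x n ρ => ((fun i => x (a i)), (fun i => n (p i))) ∈ ρ k l X :
      Query α β Δ fun _ => Prop) :=
  ⟨.rvar X a p, hX, fun _ _ _ _ _ _ _ => Iff.rfl⟩

end Definable

/-- The `k`-ary relation `R` is definable in every extension of the context. -/
structure DefinableTuple (fp : Prop) {k : ℕ} (R : Query α β Δ fun U => (Fin k → U) → Prop) : Prop where
  app : ∀ {α' β' : Type} {Δ' : List (ℕ × ℕ)} (f : α → α') (g : β → β') (h : RVarMap Δ Δ')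
    (a : Fin k → α'), Definable fp fun U G x n ρ => R U G (fun i => x (f i)) (fun i => n (g i))
      (fun k l X => ρ k l (h k l X)) fun i => x (a i)

/-- The relation `R` of type `(k, l)` is definable in every extension of the context. -/
structure DefinableRel (fp : Prop) {k l : ℕ}
    (R : Query α β Δ fun U => (Fin k → U) → (Fin l → Num U) → Prop) : Prop where
  app : ∀ {α' β' : Type} {Δ' : List (ℕ × ℕ)} (f : α → α') (g : β → β') (h : RVarMap Δ Δ')
    (a : Fin k → α') (b : Fin l → β'), Definable fp fun U G x n ρ => R U G (fun i => x (f i))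
      (fun i => n (g i)) (fun k l X => ρ k l (h k l X)) (fun i => x (a i)) fun i => n (b i)

/-! ### Monotone fixed points and recursion along the number sort -/

section FixedPoint

variable {T : Type}

lemma inflationary_mono (F : Set T → Set T) : Monotone fun i => (fun R => R ∪ F R)^[i] ∅ :=
  monotone_nat_of_le_succ fun i => by
    rw [Function.iterate_succ_apply']
    exact Set.subset_union_left

/-- The inflationary fixed point of a monotone operator is its least closed set. -/
lemma inflationaryFixedPoint_eq [Finite T] {F : Set T → Set T} (hF : Monotone F) {I : Set T}
    (hI : F I ⊆ I) (hleast : ∀ R, F R ⊆ R → I ⊆ R) : inflationaryFixedPoint F = I := by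
  refine Set.Subset.antisymm (Set.iUnion_subset fun i => ?_) (hleast _ ?_)
  · induction i with
    | zero => exact Set.empty_subset _
    | succ i ih =>
      rw [Function.iterate_succ_apply']
      exact Set.union_subset ih ((hF ih).trans hI)
  -- The increasing stages over a finite type become stationary, and the stationary stage is closed
  -- under `F`.
  · obtain ⟨N, hN⟩ := WellFoundedGT.monotone_chain_condition
      (⟨_, inflationary_mono F⟩ : ℕ →o Set T)
    have hN' : ∀ m, N ≤ m → (fun R => R ∪ F R)^[N] ∅ = (fun R => R ∪ F R)^[m] ∅ := hN
    have heq : inflationaryFixedPoint F = (fun R => R ∪ F R)^[N] ∅ := by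
      refine Set.Subset.antisymm (Set.iUnion_subset fun i => ?_)
        (Set.subset_iUnion (fun i => (fun R => R ∪ F R)^[i] ∅) N)
      rw [hN' (max i N) (le_max_right _ _)]
      exact inflationary_mono F (le_max_left _ _)
    rw [heq]
    conv_rhs => rw [hN' (N + 1) (Nat.le_succ N), Function.iterate_succ_apply']
    exact Set.subset_union_right

end FixedPoint

/-- Least fixed points of definable monotone operators are definable. -/
lemma DefinableTuple.lfp {k : ℕ} {F : Query α β Δ fun U => ((Fin k → U) → Prop) → (Fin k → U) → Prop}
    {I : Query α β Δ fun U => (Fin k → U) → Prop}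
    (hF : ∀ {α' β' : Type} {Δ' : List (ℕ × ℕ)} (X : Query α' β' Δ' fun U => (Fin k → U) → Prop),
      DefinableTuple fp X → ∀ (f : α → α') (g : β → β') (h : RVarMap Δ Δ') (a : Fin k → α'),
        Definable fp fun U G x n ρ => F U G (fun i => x (f i)) (fun i => n (g i))
          (fun k l X => ρ k l (h k l X)) (X U G x n ρ) fun i => x (a i))
    (hmono : ∀ U G x n ρ (X Y : (Fin k → U) → Prop), (∀ y, X y → Y y) →
      ∀ y, F U G x n ρ X y → F U G x n ρ Y y)
    (hclosed : ∀ U G x n ρ y, F U G x n ρ (I U G x n ρ) y → I U G x n ρ y)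
    (hleast : ∀ U G x n ρ (X : (Fin k → U) → Prop), (∀ y, F U G x n ρ X y → X y) →
      ∀ y, I U G x n ρ y → X y) : DefinableTuple fp I := by
  refine ⟨fun {α' β' Δ'} f g h a => ?_⟩
  -- The fixed-point variable, in the context extended by it, is itself a definable relation;
  -- feeding it to the operator gives the body of the fixed-point formula.
  obtain ⟨φ, hφ, hsat⟩ := hF (α' := α' ⊕ Fin k) (β' := β' ⊕ Fin 0) (Δ' := (k, 0) :: Δ')
    (fun U G x n ρ y => (y, Fin.elim0) ∈ ρ k 0 .here)
    ⟨fun f g h a => (Definable.rvar (h _ _ .here) (fun _ => rfl) a Fin.elim0).congr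
      fun U _ _ G x n ρ => by rw [Subsingleton.elim (fun i => n (Fin.elim0 i)) Fin.elim0]⟩
    (fun i => .inl (f i)) (fun i => .inl (g i)) (fun k l X => .there (h k l X)) .inr
  refine ⟨.ifp φ a Fin.elim0, fun h => ⟨rfl, hφ h⟩, fun U _ _ G x n ρ => ?_⟩
  simp only [Formula.Sat]
  have hop : (fun R : Set (Tup U k 0) => {t : Tup U k 0 | φ.Sat G.structure (Sum.elim x t.1)
      (Sum.elim n t.2) (RelAssignment.cons R ρ)}) = fun R => {t | F U G (fun i => x (f i)) (fun i => n (g i))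
        (fun k l X => ρ k l (h k l X)) (fun y => (y, Fin.elim0) ∈ R) t.1} := by
    funext R
    ext t
    exact hsat U G _ _ _
  rw [hop, inflationaryFixedPoint_eq (I := {t | I U G (fun i => x (f i)) (fun i => n (g i))
        (fun k l X => ρ k l (h k l X)) t.1})]
  · rfl
  · intro R R' hR t ht
    exact hmono _ _ _ _ _ _ _ (fun y hy => hR hy) _ ht
  · intro t ht
    exact hclosed _ _ _ _ _ _ ht
  · intro R hR t ht
    have := hleast _ _ _ _ _ (fun y => (y, Fin.elim0) ∈ R) (fun y hy => hR hy) t.1 ht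
    rwa [show t = (t.1, Fin.elim0) from Prod.ext rfl (Subsingleton.elim _ _)]

/-- Families that are defined by recursion along the number sort are definable if their levels are
not empty. -/
lemma definable_numRec (hfp : ¬ fp) {k l : ℕ}
    {S : ∀ U : Type, SimpleGraph U → ℕ → (Fin k → U) → (Fin l → Num U) → Prop}
    {F : ∀ U : Type, SimpleGraph U → ℕ → ((Fin k → U) → (Fin l → Num U) → Prop) →
      (Fin k → U) → (Fin l → Num U) → Prop}
    (hS : ∀ (U : Type) [Finite U] [Nonempty U] (G : SimpleGraph U) (e : ℕ), e < Nat.card U →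
      S U G (e + 1) = F U G e (S U G e))
    (hne : ∀ (U : Type) [Finite U] [Nonempty U] (G : SimpleGraph U) (e : ℕ), e ≤ Nat.card U →
      ∃ y z, S U G e y z)
    (h₀ : ∀ {α β : Type} {Δ : List (ℕ × ℕ)} (a : Fin k → α) (b : Fin l → β), Definable fp
      (fun U G x n _ => S U G 0 (fun i => x (a i)) fun i => n (b i) : Query α β Δ fun _ => Prop))
    (hF : ∀ {α β : Type} {Δ : List (ℕ × ℕ)}
      (X : Query α β Δ fun U => (Fin k → U) → (Fin l → Num U) → Prop), DefinableRel fp X →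
        ∀ (d : β) (a : Fin k → α) (b : Fin l → β), Definable fp
          (fun U G x n ρ => F U G (n d) (X U G x n ρ) (fun i => x (a i)) fun i => n (b i)))
    (d : β) (a : Fin k → α) (b : Fin l → β) :
    Definable fp (fun U G x n _ => S U G (n d) (fun i => x (a i)) fun i => n (b i) :
      Query α β Δ fun _ => Prop) := by
  have hX : ∀ {α β : Type} {Δ : List (ℕ × ℕ)} (e : β), DefinableRel (α := α) fp
      (fun U _ _ n ρ y z => (y, (Fin.cons (n e) z : Fin (l + 1) → Num U)) ∈ ρ k (l + 1) .here :
        Query α β ((k, l + 1) :: Δ) fun U => (Fin k → U) → (Fin l → Num U) → Prop) := by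
    refine fun {α β Δ} e => ⟨fun {α' β' Δ'} f g h a b => ?_⟩
    refine (Definable.rvar (h _ _ .here) (fun h => absurd h hfp) a
      (Fin.cons (g e) b : Fin (l + 1) → β')).congr fun U _ _ G x n ρ => ?_
    have : (fun i => n ((Fin.cons (g e) b : Fin (l + 1) → β') i)) =
        Fin.cons (n (g e)) fun i => n (b i) := by
      funext i
      refine Fin.cases ?_ (fun j => ?_) i <;> rfl
    rw [this]
  -- The leading number coordinate is the level. The demand that level `e` already has an element
  -- delays level `e + 1` until its predecessor is complete; `F` need not be monotone, so entries
  -- derived too early could be wrong and would never be removed.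
  have hbody : Definable fp (α := α ⊕ Fin k) (β := β ⊕ Fin (l + 1)) (Δ := (k, l + 1) :: Δ)
      fun U G x n ρ => ((n (.inr 0) : ℕ) = 0 ∧
          S U G 0 (fun i => x (.inr i)) fun i => n (.inr i.succ)) ∨
        ∃ e : Num U, (e : ℕ) + 1 = n (.inr 0) ∧
          (∃ t : Tup U k l, (t.1, (Fin.cons e t.2 : Fin (l + 1) → Num U)) ∈ ρ k (l + 1) .here) ∧
          F U G e (fun y z => (y, (Fin.cons e z : Fin (l + 1) → Num U)) ∈ ρ k (l + 1) .here)
            (fun i => x (.inr i)) fun i => n (.inr i.succ) := by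
    refine .or (.and (.numZero hfp _) (h₀ _ _)) (.exNum hfp (.and (.numSucc hfp none (some (Sum.inr 0)))
      (.and (.exTup hfp ?_) (hF _ (hX none) none _ fun i => some (Sum.inr i.succ)))))
    exact (hX (α := α ⊕ Fin k) none).app Sum.inl Sum.inl (fun _ _ X => X) Sum.inr Sum.inr
  obtain ⟨φ, hφ, hsat⟩ := hbody
  refine ⟨.ifp φ a (Fin.cons d b), fun h => absurd h hfp, fun U _ _ G x n ρ => ?_⟩
  simp only [Formula.Sat]
  let Φ : Set (Tup U k (l + 1)) → Set (Tup U k (l + 1)) := fun R => {t | ((t.2 0 : ℕ) = 0 ∧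
      S U G 0 t.1 fun i => t.2 i.succ) ∨
    ∃ e : Num U, (e : ℕ) + 1 = t.2 0 ∧
      (∃ t : Tup U k l, (t.1, (Fin.cons e t.2 : Fin (l + 1) → Num U)) ∈ R) ∧
      F U G e (fun y z => (y, (Fin.cons e z : Fin (l + 1) → Num U)) ∈ R) t.1 fun i => t.2 i.succ}
  have hop : (fun R : Set (Tup U k (l + 1)) => {t : Tup U k (l + 1) | φ.Sat G.structure
      (Sum.elim x t.1) (Sum.elim n t.2) (RelAssignment.cons R ρ)}) = Φ := by
    funext R
    ext t
    exact hsat U G _ _ _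
  have hΦ : ∀ R t, t ∈ Φ R ↔ ((t.2 0 : ℕ) = 0 ∧ S U G 0 t.1 fun i => t.2 i.succ) ∨
      ∃ e : Num U, (e : ℕ) + 1 = t.2 0 ∧
        (∃ t : Tup U k l, (t.1, (Fin.cons e t.2 : Fin (l + 1) → Num U)) ∈ R) ∧
        F U G e (fun y z => (y, (Fin.cons e z : Fin (l + 1) → Num U)) ∈ R) t.1
          fun i => t.2 i.succ := fun _ _ => Iff.rfl
  rw [hop]
  -- Stage `i` consists of exactly the levels below `i`, all of them complete.
  have hiter : ∀ i, (fun R => R ∪ Φ R)^[i] ∅ =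
      {t | (t.2 0 : ℕ) < i ∧ S U G (t.2 0) t.1 fun i => t.2 i.succ} := by
    intro i
    induction i with
    | zero =>
      ext t
      simp
    | succ i ih =>
      rw [Function.iterate_succ_apply', ih]
      ext t
      simp only [Set.mem_union, hΦ, Set.mem_ofPred_eq, Fin.cons_zero, Fin.cons_succ]
      constructor
      · rintro (⟨h, h'⟩ | ⟨h, h'⟩ | ⟨e, he, ⟨t', hlt, -⟩, h⟩)
        · exact ⟨by omega, h'⟩
        · rw [h]
          exact ⟨by omega, h'⟩
        · rw [← he, hS U G e (by have := (t.2 0).2; omega)]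
          refine ⟨by omega, ?_⟩
          simpa only [hlt, true_and] using h
      · rintro ⟨hlt, h⟩
        by_cases h0 : (t.2 0 : ℕ) = 0
        · rw [h0] at h
          exact .inr (.inl ⟨h0, h⟩)
        · have h2 := (t.2 0).2
          have he : ((t.2 0 : ℕ) - 1) + 1 = t.2 0 := by omega
          rw [← he, hS U G _ (by omega)] at h
          obtain ⟨y, z, hyz⟩ := hne U G ((t.2 0 : ℕ) - 1) (by omega)
          refine .inr (.inr ⟨⟨(t.2 0 : ℕ) - 1, by omega⟩, he, ⟨(y, z), ?_, hyz⟩, ?_⟩)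
          · simp only
            omega
          · have hlt' : (t.2 0 : ℕ) - 1 < i := by omega
            simpa only [hlt', true_and] using h
  rw [inflationaryFixedPoint, Set.mem_iUnion]
  simp only [hiter, Set.mem_ofPred_eq, Fin.cons_zero, Fin.cons_succ]
  exact ⟨fun ⟨_, _, h⟩ => h, fun h => ⟨n d + 1, Nat.lt_succ_self _, h⟩⟩

end Definability
end FPC

namespace FPC

section DefinableNotions

variable {fp : Prop} {α β : Type} {Δ : List (ℕ × ℕ)}

/-! ### Definability of the decomposition and of the canonical codes -/

/-- Quantifiers and fixed points introduce new variables under which the same relation is used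
again; hence definability of relations is required in all extensions of the context and is stable
under renaming. -/
lemma Definable₁.comp {M : Query α β Δ fun U => U → Prop} (hM : Definable₁ fp M) {α' β' : Type}
    {Δ' : List (ℕ × ℕ)} (f : α → α') (g : β → β') (h : RVarMap Δ Δ') :
    Definable₁ fp fun U G x n ρ => M U G (fun i => x (f i)) (fun i => n (g i))
      (fun k l X => ρ k l (h k l X)) :=
  ⟨fun f' g' h' a => hM.app (fun i => f' (f i)) (fun i => g' (g i)) (fun k l X => h' k l (h k l X)) a⟩

lemma Definable₂.comp {R : Query α β Δ fun U => U → U → Prop} (hR : Definable₂ fp R)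
    {α' β' : Type} {Δ' : List (ℕ × ℕ)} (f : α → α') (g : β → β') (h : RVarMap Δ Δ') :
    Definable₂ fp fun U G x n ρ => R U G (fun i => x (f i)) (fun i => n (g i))
      (fun k l X => ρ k l (h k l X)) :=
  ⟨fun f' g' h' a b =>
    hR.app (fun i => f' (f i)) (fun i => g' (g i)) (fun k l X => h' k l (h k l X)) a b⟩

lemma DefinableCodes.comp {A : Query α β Δ fun U => U → Code U} (hA : DefinableCodes fp A)
    {α' β' : Type} {Δ' : List (ℕ × ℕ)} (f : α → α') (g : β → β') (h : RVarMap Δ Δ') :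
    DefinableCodes fp fun U G x n ρ => A U G (fun i => x (f i)) (fun i => n (g i))
      (fun k l X => ρ k l (h k l X)) :=
  ⟨fun f' g' h' a p q =>
    hA.app (fun i => f' (f i)) (fun i => g' (g i)) (fun k l X => h' k l (h k l X)) a p q⟩

lemma DefinableCodes.code {A : Query α β Δ fun U => U → Code U} (hA : DefinableCodes fp A)
    (a : α) : DefinableCode fp fun U G x n ρ => A U G x n ρ (x a) :=
  ⟨fun f g h p q => hA.app f g h (f a) p q⟩

lemma definable₂_adj :
    Definable₂ fp (fun _ G _ _ _ => G.Adj : Query α β Δ fun U => U → U → Prop) :=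
  ⟨fun _ _ _ a b => .adj a b⟩

lemma definable₂_nonAdj :
    Definable₂ fp (fun _ G _ _ _ => NonAdj G : Query α β Δ fun U => U → U → Prop) :=
  ⟨fun _ _ _ a b => (Definable.adj a b).not⟩

lemma DefinableTuple.app₁ {X : Query α β Δ fun U => (Fin 1 → U) → Prop}
    (hX : DefinableTuple fp X) {α' β' : Type} {Δ' : List (ℕ × ℕ)} (f : α → α') (g : β → β')
    (h : RVarMap Δ Δ') (a : α') : Definable fp fun U G x n ρ => X U G (fun i => x (f i))
      (fun i => n (g i)) (fun k l X => ρ k l (h k l X)) ![x a] :=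
  (hX.app f g h ![a]).congr fun U _ _ G x n ρ => by
    rw [show (fun i => x (![a] i)) = ![x a] from funext fun i => by fin_cases i; rfl]

lemma DefinableTuple.app₄ {X : Query α β Δ fun U => (Fin 4 → U) → Prop}
    (hX : DefinableTuple fp X) {α' β' : Type} {Δ' : List (ℕ × ℕ)} (f : α → α') (g : β → β')
    (h : RVarMap Δ Δ') (a b c d : α') : Definable fp fun U G x n ρ => X U G (fun i => x (f i))
      (fun i => n (g i)) (fun k l X => ρ k l (h k l X)) ![x a, x b, x c, x d] :=
  (hX.app f g h ![a, b, c, d]).congr fun U _ _ G x n ρ => by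
    rw [show (fun i => x (![a, b, c, d] i)) = ![x a, x b, x c, x d] from
      funext fun i => by fin_cases i <;> rfl]

/-! ### Definability of the split and of the reconstruction -/

namespace Definable

lemma linked {R E : Query α β Δ fun U => U → U → Prop} (hR : Definable₂ fp R)
    (hE : Definable₂ fp E) (a b : α) :
    Definable fp fun U G x n ρ => Linked (R U G x n ρ) (E U G x n ρ) (x a) (x b) := by
  refine (DefinableTuple.lfp (k := 1)
    (F := fun U G x n ρ X y => y 0 = x a ∨
      ∃ z, X ![z] ∧ R U G x n ρ z (y 0) ∧ E U G x n ρ z (y 0))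
    (I := fun U G x n ρ y => Linked (R U G x n ρ) (E U G x n ρ) (x a) (y 0))
    ?_ ?_ ?_ ?_).app id id (fun _ _ X => X) fun _ => b
  · intro α' β' Δ' X hX f g h c
    exact .or (.eq _ _) (.ex (.and (hX.app₁ _ _ _ _) (.and (hR.app _ _ _ _ _) (hE.app _ _ _ _ _))))
  · rintro U G x n ρ X Y hXY y (h | ⟨z, hz, h⟩)
    · exact .inl h
    · exact .inr ⟨z, hXY _ hz, h⟩
  · rintro U G x n ρ y (h | ⟨z, hz, h⟩)
    · rw [h]
      exact .refl
    · exact .tail hz h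
  · intro U G x n ρ X hX y hy
    have : ∀ z, Linked (R U G x n ρ) (E U G x n ρ) (x a) z → X ![z] := by
      intro z hz
      induction hz with
      | refl => exact hX _ (.inl rfl)
      | tail _ h ih => exact hX _ (.inr ⟨_, ih, h⟩)
    rw [show y = ![y 0] from funext fun i => by rw [Subsingleton.elim i 0]; rfl]
    exact this _ hy

lemma moduleClosure {R : Query α β Δ fun U => U → U → Prop} (hR : Definable₂ fp R) (a b c : α) :
    Definable fp fun U G x n ρ => ModuleClosure G (R U G x n ρ) (x a) (x b) (x c) := by
  refine (DefinableTuple.lfp (k := 1)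
    (F := fun U G x n ρ X y => y 0 = x a ∨ y 0 = x b ∨ (R U G x n ρ (x a) (y 0) ∧
      ∃ z z', X ![z] ∧ X ![z'] ∧ G.Adj (y 0) z ∧ ¬ G.Adj (y 0) z'))
    (I := fun U G x n ρ y => ModuleClosure G (R U G x n ρ) (x a) (x b) (y 0))
    ?_ ?_ ?_ ?_).app id id (fun _ _ X => X) fun _ => c
  · intro α' β' Δ' X hX f g h c
    exact .or (.eq _ _) (.or (.eq _ _) (.and (hR.app _ _ _ _ _) (.ex (.ex (.and (hX.app₁ _ _ _ _)
      (.and (hX.app₁ _ _ _ _) (.and (.adj _ _) (.not (.adj _ _)))))))))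
  · rintro U G x n ρ X Y hXY y (h | h | ⟨h, z, z', hz, hz', h'⟩)
    · exact .inl h
    · exact .inr (.inl h)
    · exact .inr (.inr ⟨h, z, z', hXY _ hz, hXY _ hz', h'⟩)
  · rintro U G x n ρ y (h | h | ⟨h, z, z', hz, hz', h₁, h₂⟩)
    · simp only [h]
      exact .left
    · simp only [h]
      exact .right
    · exact .step h hz hz' h₁ h₂
  · intro U G x n ρ X hX y hy
    have : ∀ z, ModuleClosure G (R U G x n ρ) (x a) (x b) z → X ![z] := by
      intro z hz
      induction hz with
      | left => exact hX _ (.inl rfl)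
      | right => exact hX _ (.inr (.inl rfl))
      | step h _ _ h₁ h₂ ih ih' => exact hX _ (.inr (.inr ⟨h, _, _, ih, ih', h₁, h₂⟩))
    rw [show y = ![y 0] from funext fun i => by rw [Subsingleton.elim i 0]; rfl]
    exact this _ hy

lemma disconnected {R E : Query α β Δ fun U => U → U → Prop} (hR : Definable₂ fp R)
    (hE : Definable₂ fp E) (a : α) :
    Definable fp fun U G x n ρ => Disconnected (R U G x n ρ) (E U G x n ρ) (x a) :=
  .ex (.and (hR.app _ _ _ _ _) (.not (.linked (hR.comp _ _ _) (hE.comp _ _ _) _ _)))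

lemma split {R : Query α β Δ fun U => U → U → Prop} (hR : Definable₂ fp R) (a b : α) :
    Definable fp fun U G x n ρ => split G (R U G x n ρ) (x a) (x b) := by
  have h₁ := disconnected hR definable₂_adj a
  have h₂ := disconnected hR definable₂_nonAdj a
  exact .and (hR.app id id (fun _ _ X => X) a b) (.or (.and h₁ (.linked hR definable₂_adj a b))
    (.or (.and h₁.not (.and h₂ (.linked hR definable₂_nonAdj a b))) (.and h₁.not (.and h₂.not
      (.or (.eq a b) (.ex (.and (hR.app _ _ _ _ _) (.not (.moduleClosure (hR.comp _ _ _) _ _ _)))))))))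

/-- The simultaneous recursion of the two relations becomes one 4-ary fixed point, in which equality
of the first two entries encodes the tag. This avoids number variables and so stays within FP. -/
lemma rec_tagged {M : Query α β Δ fun U => U → Prop} {s : Query α β Δ fun U => U → U → Prop}
    (hM : Definable₁ fp M) (hs : Definable₂ fp s) (w : α) :
    DefinableTuple (k := 4) fp fun U G x n ρ y => ∃ b : Bool, (b = true ↔ y 0 = y 1) ∧
      Rec G (M U G x n ρ) (s U G x n ρ) (x w) b (y 2) (y 3) := by
  refine DefinableTuple.lfp (k := 4)
    (F := fun U G x n ρ X y => (y 0 = y 1 ∧ (M U G x n ρ (y 2) ∧ (M U G x n ρ (y 3) ∧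
        (s U G x n ρ (x w) (y 2) ∧ ¬ s U G x n ρ (x w) (y 3))))) ∨
      ((∃ a b, (a = b ↔ ¬ y 0 = y 1) ∧ ((X ![a, b, y 3, y 2] ∧ G.Adj (y 3) (y 2)) ∨
        (X ![a, b, y 2, y 3] ∧ ¬ G.Adj (y 2) (y 3)))) ∨
      ∃ z, X ![y 0, y 1, y 2, z] ∧ X ![y 0, y 1, z, y 3])) ?_ ?_ ?_ ?_
  · intro α' β' Δ' X hX f g h c
    refine .or (.and (.eq _ _) (.and (hM.app _ _ _ _) (.and (hM.app _ _ _ _) (.and (hs.app _ _ _ _ _)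
      (.not (hs.app _ _ _ _ _)))))) (.or (.ex (.ex (.and (.iff (.eq _ _) (.not (.eq _ _))) (.or
        (.and (hX.app₄ _ _ _ _ _ _ _) (.adj _ _))
        (.and (hX.app₄ _ _ _ _ _ _ _) (.not (.adj _ _)))))))
      (.ex (.and (hX.app₄ _ _ _ _ _ _ _) (hX.app₄ _ _ _ _ _ _ _))))
  · rintro U G x n ρ X Y hXY y (h | ⟨a, b, hab, h⟩ | ⟨z, h, h'⟩)
    · exact .inl h
    · exact .inr (.inl ⟨a, b, hab, h.imp (fun h => ⟨hXY _ h.1, h.2⟩) fun h => ⟨hXY _ h.1, h.2⟩⟩)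
    · exact .inr (.inr ⟨z, hXY _ h, hXY _ h'⟩)
  · rintro U G x n ρ y (⟨h, h₁, h₂, h₃, h₄⟩ |
      ⟨a, b, hab, ⟨⟨c, hc, h⟩, h'⟩ | ⟨⟨c, hc, h⟩, h'⟩⟩ | ⟨z, ⟨c, hc, h⟩, ⟨c', hc', h'⟩⟩)
    · exact ⟨true, by simpa using h, .base h₁ h₂ h₃ h₄⟩
    · refine ⟨!c, ?_, .adj h h'⟩
      have hc : c = true ↔ a = b := hc
      rw [Bool.not_eq_true', ← Bool.not_eq_true, hc, hab, not_not]
    · refine ⟨!c, ?_, .nadj h h'⟩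
      have hc : c = true ↔ a = b := hc
      rw [Bool.not_eq_true', ← Bool.not_eq_true, hc, hab, not_not]
    · have hcc : c = c' := by
        rw [Bool.eq_iff_iff]
        exact hc.trans hc'.symm
      subst hcc
      exact ⟨c, hc, .trans h h'⟩
  · rintro U G x n ρ X hX y ⟨b, hb, h⟩
    have key : ∀ b u v, Rec G (M U G x n ρ) (s U G x n ρ) (x w) b u v →
        ∀ a a', (b = true ↔ a = a') → X ![a, a', u, v] := by
      intro b u v h
      -- A premise with the opposite tag must be represented by some pair of vertices; a derivation
      -- guarantees the two distinct vertices this may need.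
      have htag : ∀ b : Bool, Nontrivial U → ∃ c c' : U, b = true ↔ c = c' := by
        intro b _
        obtain ⟨c, c', hc⟩ := exists_pair_ne U
        cases b
        · exact ⟨c, c', by simpa using hc⟩
        · exact ⟨c, c, by simp⟩
      induction h with
      | base h₁ h₂ h₃ h₄ =>
        intro a a' haa
        exact hX _ (.inl ⟨haa.1 rfl, h₁, h₂, h₃, h₄⟩)
      | @adj b u v h huv ih =>
        intro a a' haa
        obtain ⟨c, c', hc⟩ := htag b h.nontrivial
        refine hX _ (.inr (.inl ⟨c, c', ?_, .inl ⟨ih c c' hc, huv⟩⟩))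
        rw [← hc]
        show _ ↔ ¬ a = a'
        rw [← haa]
        simp
      | @nadj b u v h huv ih =>
        intro a a' haa
        obtain ⟨c, c', hc⟩ := htag b h.nontrivial
        refine hX _ (.inr (.inl ⟨c, c', ?_, .inr ⟨ih c c' hc, huv⟩⟩))
        rw [← hc]
        show _ ↔ ¬ a = a'
        rw [← haa]
        simp
      | trans _ _ ih ih' =>
        intro a a' haa
        exact hX _ (.inr (.inr ⟨_, ih a a' haa, ih' a a' haa⟩))
    rw [show y = ![y 0, y 1, y 2, y 3] from funext fun i => by fin_cases i <;> rfl]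
    exact key b _ _ h _ _ hb

lemma rec_true {M : Query α β Δ fun U => U → Prop} {s : Query α β Δ fun U => U → U → Prop}
    (hM : Definable₁ fp M) (hs : Definable₂ fp s) (w a b : α) :
    Definable fp fun U G x n ρ => Rec G (M U G x n ρ) (s U G x n ρ) (x w) true (x a) (x b) :=
  ((rec_tagged hM hs w).app id id (fun _ _ X => X) ![a, a, a, b]).congr fun U _ _ G x n ρ => by
    refine ⟨fun h => ⟨true, by simp, h⟩, ?_⟩
    rintro ⟨c, hc, h⟩
    rwa [hc.2 rfl] at h

lemma rec_false {M : Query α β Δ fun U => U → Prop} {s : Query α β Δ fun U => U → U → Prop}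
    (hM : Definable₁ fp M) (hs : Definable₂ fp s) (w a b : α) :
    Definable fp fun U G x n ρ => Rec G (M U G x n ρ) (s U G x n ρ) (x w) false (x a) (x b) := by
  have h₁ : Definable fp (fun U G x n ρ => ∃ c c' : U, ¬ c = c' ∧ ∃ t : Bool, (t = true ↔ c = c') ∧
      Rec G (M U G x n ρ) (s U G x n ρ) (x w) t (x a) (x b)) := by
    refine .ex (.ex (.and (.not (.eq _ _)) ?_))
    exact (rec_tagged hM hs w).app (fun a => some (some a)) id (fun _ _ X => X)
      ![some none, none, some (some a), some (some b)]
  refine h₁.congr fun U _ _ G x n ρ => ⟨fun h => ?_, ?_⟩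
  · have := h.nontrivial
    obtain ⟨c, c', hc⟩ := exists_pair_ne U
    exact ⟨c, c', hc, false, by simpa using hc, h⟩
  · rintro ⟨c, c', hne, t, ht, h⟩
    have : t = false := by simpa using mt ht.1 hne
    rwa [this] at h

lemma codeLE (hfp : ¬ fp) {A B : Query α β Δ Code} (hA : DefinableCode fp A)
    (hB : DefinableCode fp B) :
    Definable fp fun U G x n ρ => CodeLE (A U G x n ρ) (B U G x n ρ) :=
  .not (.exNum hfp (.exNum hfp (.and (.not (hB.app _ _ _ _ _)) (.and (hA.app _ _ _ _ _)
    (.allNum hfp (.allNum hfp (.imp (.or (.numLT hfp _ _) (.and (.numEq hfp _ _)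
      (.numLT hfp _ _))) (.iff (hB.app _ _ _ _ _) (hA.app _ _ _ _ _)))))))))

/-! ### Definability of one canonization step -/

section Step

variable {M : Query α β Δ fun U => U → Prop} {s P : Query α β Δ fun U => U → U → Prop}
  {A : Query α β Δ fun U => U → Code U}

lemma placedAt (hfp : ¬ fp) (hM : Definable₁ fp M) (hs : Definable₂ fp s) (hP : Definable₂ fp P)
    (a : α) (j i p : β) : Definable fp fun U G x n ρ =>
      PlacedAt (M U G x n ρ) (s U G x n ρ) (P U G x n ρ) (x a) (n j) (n i) (n p) := by
  have h : Definable fp fun U G x n ρ => ∃ l c u d e : Num U,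
      (lowerCount (M U G x n ρ) (P U G x n ρ) (x a) = l ∧ classSize (s U G x n ρ) (x a) = c ∧
        upperCount (M U G x n ρ) (P U G x n ρ) (x a) = u) ∧ (n j : ℕ) * c = d ∧ (l : ℕ) + d = e ∧
        (e : ℕ) + n i = n p ∧ n i < c ∧ n p < u := by
    refine .exNum hfp (.exNum hfp (.exNum hfp (.exNum hfp (.exNum hfp (.and (.and ?_ (.and ?_ ?_))
      (.and (.numMul hfp _ _ _) (.and (.numAdd hfp _ _ _) (.and (.numAdd hfp _ _ _)
        (.and (.numLT hfp _ _) (.numLT hfp _ _))))))))))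
    · exact .countVertices hfp (.and (hM.app _ _ _ _) (.and (hP.app _ _ _ _ _) (.not (hP.app _ _ _ _ _)))) _
    · exact .countVertices hfp (hs.app _ _ _ _ _) _
    · exact .countVertices hfp (.and (hM.app _ _ _ _) (hP.app _ _ _ _ _)) _
  refine h.congr fun U _ _ G x n ρ => ⟨?_, ?_⟩
  · rintro ⟨h₁, h₂, h₃⟩
    -- All partial sums are at most `n p`, so they lie in the number sort.
    have hp := (n p).2
    refine ⟨⟨_, ncard_lt_num _⟩, ⟨_, ncard_lt_num _⟩, ⟨_, ncard_lt_num _⟩,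
      ⟨(n j : ℕ) * classSize (s U G x n ρ) (x a), by omega⟩,
      ⟨lowerCount (M U G x n ρ) (P U G x n ρ) (x a) +
        (n j : ℕ) * classSize (s U G x n ρ) (x a), by omega⟩, ⟨rfl, rfl, rfl⟩, rfl, rfl, h₁.symm,
      Fin.lt_def.2 h₂, Fin.lt_def.2 h₃⟩
  · rintro ⟨l, c, u, d, e, ⟨hl, hc, hu⟩, hd, he, hp, hi, hpu⟩
    rw [PlacedAt, hl, hc, hu, hd, he]
    exact ⟨hp.symm, hi, hpu⟩

lemma concat (hfp : ¬ fp) (hM : Definable₁ fp M) (hs : Definable₂ fp s)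
    (hA : DefinableCodes fp A) (hP : Definable₂ fp P) (p q : β) : Definable fp fun U G x n ρ =>
      concat G (M U G x n ρ) (s U G x n ρ) (A U G x n ρ) (P U G x n ρ) (n p) (n q) :=
  .ex (.ex (.and (.and (hM.app _ _ _ _) (hM.app _ _ _ _)) (.exNum hfp (.exNum hfp (.exNum hfp
    (.exNum hfp (.and (.placedAt hfp (hM.comp _ _ _) (hs.comp _ _ _) (hP.comp _ _ _) _ _ _ _)
      (.and (.placedAt hfp (hM.comp _ _ _) (hs.comp _ _ _) (hP.comp _ _ _) _ _ _ _)
        (.or (.and (hs.app _ _ _ _ _) (.and (.numEq hfp _ _) (hA.app _ _ _ _ _ _)))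
          (.and (.not (hs.app _ _ _ _ _)) (.and (.adj _ _) (.imp (hP.app _ _ _ _ _)
            (.imp (hP.app _ _ _ _ _) (.not (.numEq hfp _ _)))))))))))))))

lemma isGoodOrder (hfp : ¬ fp) (hM : Definable₁ fp M) (hs : Definable₂ fp s)
    (hA : DefinableCodes fp A) (hP : Definable₂ fp P) : Definable fp fun U G x n ρ =>
      IsGoodOrder G (M U G x n ρ) (s U G x n ρ) (A U G x n ρ) (P U G x n ρ) := by
  refine .and (.all (.all (.imp (hM.app _ _ _ _) (.imp (hM.app _ _ _ _)
    (.or (hP.app _ _ _ _ _) (hP.app _ _ _ _ _)))))) (.and ?_ (.and ?_ (.and ?_ ?_)))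
  · exact .all (.all (.all (.imp (hM.app _ _ _ _) (.imp (hM.app _ _ _ _) (.imp (hM.app _ _ _ _)
      (.imp (hP.app _ _ _ _ _) (.imp (hP.app _ _ _ _ _) (hP.app _ _ _ _ _))))))))
  · exact .all (.all (.imp (hM.app _ _ _ _) (.imp (hM.app _ _ _ _)
      (.imp (hs.app _ _ _ _ _) (hP.app _ _ _ _ _)))))
  · exact .all (.all (.imp (hM.app _ _ _ _) (.imp (hM.app _ _ _ _) (.imp (hP.app _ _ _ _ _)
      (.imp (hP.app _ _ _ _ _) (.allNum hfp (.allNum hfp (.iff (hA.app _ _ _ _ _ _)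
        (hA.app _ _ _ _ _ _)))))))))
  · exact .all (.all (.all (.all (.imp (hM.app _ _ _ _) (.imp (hM.app _ _ _ _) (.imp (hM.app _ _ _ _)
      (.imp (hM.app _ _ _ _) (.imp (.not (hs.app _ _ _ _ _)) (.imp (.not (hs.app _ _ _ _ _))
        (.imp (hP.app _ _ _ _ _) (.imp (hP.app _ _ _ _ _) (.imp (hP.app _ _ _ _ _) (.imp (hP.app _ _ _ _ _)
          (.iff (.adj _ _) (.adj _ _)))))))))))))))

lemma isHomogeneous (hM : Definable₁ fp M) (hs : Definable₂ fp s) :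
    Definable fp fun U G x n ρ => IsHomogeneous G (M U G x n ρ) (s U G x n ρ) :=
  .or (.all (.all (.imp (hM.app _ _ _ _) (.imp (hM.app _ _ _ _) (.imp (.not (hs.app _ _ _ _ _))
      (.not (.adj _ _)))))))
    (.all (.all (.imp (hM.app _ _ _ _) (.imp (hM.app _ _ _ _) (.imp (.not (hs.app _ _ _ _ _)) (.adj _ _))))))

lemma candidate (hfp : ¬ fp) (hM : Definable₁ fp M) (hs : Definable₂ fp s)
    (hA : DefinableCodes fp A) (w : α) : Definable₂ fp fun U G x n ρ =>
      candidate G (M U G x n ρ) (s U G x n ρ) (A U G x n ρ) (x w) := by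
  refine ⟨fun f g h a b => ?_⟩
  have hH := isHomogeneous (hM.comp f g h) (hs.comp f g h)
  exact .or (.and hH (.codeLE hfp ((hA.comp f g h).code a) ((hA.comp f g h).code b)))
    (.and hH.not (.or (hs.app _ _ _ _ _) (.rec_true (hM.comp f g h) (hs.comp f g h) _ _ _)))

lemma canonStep (hfp : ¬ fp) (hM : Definable₁ fp M) (hs : Definable₂ fp s)
    (hA : DefinableCodes fp A) (p q : β) : Definable fp fun U G x n ρ =>
      canonStep G (M U G x n ρ) (s U G x n ρ) (A U G x n ρ) (n p) (n q) := by
  have hc : ∀ {α' β' : Type} {Δ' : List (ℕ × ℕ)} (f : α → α') (g : β → β') (h : RVarMap Δ Δ')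
      (w : α'), Definable₂ fp fun U G x n ρ =>
        FPC.candidate G (M U G (fun i => x (f i)) (fun i => n (g i)) fun k l X => ρ k l (h k l X))
          (s U G (fun i => x (f i)) (fun i => n (g i)) fun k l X => ρ k l (h k l X))
          (A U G (fun i => x (f i)) (fun i => n (g i)) fun k l X => ρ k l (h k l X)) (x w) :=
    fun f g h w => candidate hfp (hM.comp f g h) (hs.comp f g h) (hA.comp f g h) w
  refine .ex (.and (hM.app _ _ _ _) (.and ?_ (.and (.all (.imp (hM.app _ _ _ _) (.imp ?_
    (.codeLE hfp ?_ ?_)))) ?_)))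
  · exact isGoodOrder hfp (hM.comp _ _ _) (hs.comp _ _ _) (hA.comp _ _ _) (hc some id _ none)
  · exact isGoodOrder hfp (hM.comp _ _ _) (hs.comp _ _ _) (hA.comp _ _ _)
      (hc (fun a => some (some a)) id _ none)
  · exact ⟨fun f g h p q => concat hfp (hM.comp _ _ _) (hs.comp _ _ _) (hA.comp _ _ _)
      (hc (fun a => f (some (some a))) g h (f (some none))) _ _⟩
  · exact ⟨fun f g h p q => concat hfp (hM.comp _ _ _) (hs.comp _ _ _) (hA.comp _ _ _)
      (hc (fun a => f (some (some a))) g h (f none)) _ _⟩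
  · exact concat hfp (hM.comp _ _ _) (hs.comp _ _ _) (hA.comp _ _ _) (hc some id _ none) _ _

end Step

/-! ### Definability of the levels and of the canonical codes -/

lemma level (hfp : ¬ fp) (d : β) (a b : α) : Definable fp
    (fun _ G x n _ => level G (n d) (x a) (x b) : Query α β Δ fun _ => Prop) := by
  refine definable_numRec hfp (k := 2) (l := 0)
    (S := fun U G e y _ => FPC.level G e (y 0) (y 1))
    (F := fun U G e X y _ => FPC.split G (fun u v => X ![u, v] ![]) (y 0) (y 1))
    (fun U _ _ G e _ => rfl) ?_ ?_ ?_ d ![a, b] Fin.elim0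
  · intro U _ _ G e _
    exact ⟨fun _ => Classical.arbitrary U, Fin.elim0, (equivalence_level G e).refl _⟩
  · exact fun _ _ => .verum
  · intro α β Δ X hX d a b
    refine split ⟨fun f g h a b => (hX.app f g h ![a, b] Fin.elim0).congr
      fun U _ _ G x n ρ => ?_⟩ _ _
    rw [show (fun i => x (![a, b] i)) = ![x a, x b] from funext fun i => by fin_cases i <;> rfl,
      Subsingleton.elim (fun i => n (Fin.elim0 i)) ![]]

lemma numMax (hfp : ¬ fp) (p : β) : Definable fp
    (fun U _ _ n _ => (n p : ℕ) = Nat.card U : Query α β Δ fun _ => Prop) :=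
  (allNum hfp (Q := fun _ _ _ n _ q => q ≤ n p) (numLE hfp _ _)).congr fun U _ _ _ _ n _ => by
    have hp := (n p).2
    constructor
    · intro h q
      rw [Fin.le_def, h]
      exact Nat.le_of_lt_succ q.2
    · intro h
      have := Fin.le_def.1 (h ⟨Nat.card U, Nat.lt_succ_self _⟩)
      simp only at this
      omega

lemma level_card_sub (hfp : ¬ fp) (e : β) : Definable₂ fp
    (fun U G _ n _ => FPC.level G (Nat.card U - n e) :
      Query α β Δ fun U => U → U → Prop) := by
  refine ⟨fun {α' β' Δ'} f g h a b => ?_⟩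
  have : Definable fp (fun U G x n _ => ∃ m d : Num U, (m : ℕ) = Nat.card U ∧
      (d : ℕ) + n (g e) = m ∧ FPC.level G d (x a) (x b) : Query α' β' Δ' fun _ => Prop) :=
    .exNum hfp (.exNum hfp (.and (.numMax hfp _) (.and (.numAdd hfp _ _ _) (.level hfp _ _ _))))
  refine this.congr fun U _ _ G x n ρ => ?_
  have he := (n (g e)).2
  constructor
  · intro h
    exact ⟨⟨Nat.card U, by omega⟩, ⟨Nat.card U - n (g e), by omega⟩, rfl,
      Nat.sub_add_cancel (by omega), h⟩
  · rintro ⟨m, d, hm, hd, h⟩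
    rwa [show Nat.card U - n (g e) = d by omega]

lemma level_card_sub_succ (hfp : ¬ fp) (e : β) : Definable₂ fp
    (fun U G _ n _ => FPC.level G (Nat.card U - (n e + 1)) :
      Query α β Δ fun U => U → U → Prop) := by
  refine ⟨fun {α' β' Δ'} f g h a b => ?_⟩
  -- The alternative with both numbers 0 accounts for truncated subtraction when `n (g e)` is |V|.
  have : Definable fp (fun U G x n _ => ∃ m d d' : Num U, (m : ℕ) = Nat.card U ∧
      (d' : ℕ) + n (g e) = m ∧ ((d : ℕ) + 1 = d' ∨ ((d : ℕ) = 0 ∧ (d' : ℕ) = 0)) ∧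
      FPC.level G d (x a) (x b) : Query α' β' Δ' fun _ => Prop) :=
    .exNum hfp (.exNum hfp (.exNum hfp (.and (.numMax hfp _) (.and (.numAdd hfp _ _ _)
      (.and (.or (.numSucc hfp _ _) (.and (.numZero hfp _) (.numZero hfp _)))
        (.level hfp _ _ _))))))
  refine this.congr fun U _ _ G x n ρ => ?_
  have he := (n (g e)).2
  constructor
  · intro h
    refine ⟨⟨Nat.card U, by omega⟩, ⟨Nat.card U - (n (g e) + 1), by omega⟩,
      ⟨Nat.card U - n (g e), by omega⟩, rfl, Nat.sub_add_cancel (by omega), ?_, h⟩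
    simp only
    omega
  · rintro ⟨m, d, d', hm, hd', hd, h⟩
    rwa [show Nat.card U - (n (g e) + 1) = d by omega]

lemma canonCode (hfp : ¬ fp) (e : β) (a : α) (p q : β) : Definable fp
    (fun _ G x n _ => canonCode G (n e) (x a) (n p) (n q) : Query α β Δ fun _ => Prop) := by
  refine definable_numRec hfp (k := 1) (l := 2)
    (S := fun U G e y z => FPC.canonCode G e (y 0) (z 0) (z 1))
    (F := fun U G e X y z => FPC.canonStep G (FPC.level G (Nat.card U - (e + 1)) (y 0))
      (FPC.level G (Nat.card U - e)) (fun v p q => X ![v] ![p, q]) (z 0) (z 1) ∨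
      ((z 0 : ℕ) = 0 ∧ (z 1 : ℕ) = 0))
    (fun U _ _ G e _ => rfl) ?_ ?_ ?_ e ![a] ![p, q]
  · intro U _ _ G e _
    exact ⟨fun _ => Classical.arbitrary U, fun _ => 0, canonCode_zero G e _⟩
  · exact fun _ _ => .and (.numZero hfp _) (.numZero hfp _)
  · intro α β Δ X hX d a b
    refine .or (canonStep hfp ⟨fun f g h c => (level_card_sub_succ hfp d).app f g h (f (a 0)) c⟩
      (level_card_sub hfp d) ⟨fun f g h a p q => ?_⟩ _ _) (.and (.numZero hfp _) (.numZero hfp _))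
    refine (hX.app f g h ![a] ![p, q]).congr fun U _ _ G x n ρ => ?_
    rw [show (fun i => x (![a] i)) = ![x a] from funext fun i => by fin_cases i; rfl,
      show (fun i => n (![p, q] i)) = ![n p, n q] from funext fun i => by fin_cases i <;> rfl]

end Definable

end DefinableNotions
end FPC

namespace FPC

open FirstOrder

/-! ### The canonization -/

/-- A transduction canonizes `G` if its output is the ordered graph with the code `B`, the elements
of the universe being represented by numbers. -/
theorem canonizes_of_isCodeOf {V : Type} [Finite V] [Nonempty V] {G : SimpleGraph V}
    {Θ : Transduction Language.graph (WithOrder Language.graph)} {B : Code V}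
    (hB : IsCodeOf G (fun _ => True) B)
    (hdom : Θ.dom.Sat G.structure Empty.elim Empty.elim RelAssignment.nil)
    (val : Tup V Θ.k Θ.l → Num V) (hval : ∀ p, ∃ t, val t = p)
    (hequiv : ∀ t t', Θ.Equiv G.structure t t' ↔ val t = val t')
    (huniv : ∀ t, Θ.Univ G.structure t ↔ (val t : ℕ) < Nat.card V)
    (hedge : ∀ t, Θ.Rel G.structure
        (Sum.inl Language.adj : (WithOrder Language.graph).Relations 2) t ↔
      ¬ val (t 0) = val (t 1) ∧ B (val (t 0)) (val (t 1)))
    (hle : ∀ t, Θ.Rel G.structure (Language.leSymb : (WithOrder Language.graph).Relations 2) t ↔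
      val (t 0) ≤ val (t 1)) : Θ.Canonizes G.structure := by
  obtain ⟨π, hinj, hlt, hB⟩ := hB
  have hcard : {y : V | (fun _ => True) y}.ncard = Nat.card V := Set.ncard_univ V
  rw [hcard] at hlt
  -- The formula for equivalence compares values, so the generated quotient identifies exactly the
  -- tuples with equal value.
  let num : Θ.Carrier G.structure → Num V := fun a =>
    Quot.lift val (fun t t' h => (hequiv t t').1 h) a.1
  have hmk : ∀ {t} {a : Θ.Carrier G.structure}, Quot.mk _ t = a.1 ↔ val t = num a := by
    intro t a
    constructor
    · intro h
      simp only [num, ← h]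
    · obtain ⟨q, t', ht', rfl⟩ := a
      exact fun h => Quot.sound ((hequiv _ _).2 h)
  have hnum : ∀ {a b}, num a = num b → a = b := by
    intro a b h
    obtain ⟨t, ht⟩ := hval (num a)
    exact Subtype.ext ((hmk.2 ht).symm.trans (hmk.2 (ht.trans h)))
  have hnumlt : ∀ a, (num a : ℕ) < Nat.card V := by
    rintro ⟨q, t, ht, rfl⟩
    exact (huniv t).1 ht
  have hrel : ∀ (R : (WithOrder Language.graph).Relations 2) (p : Num V → Num V → Prop),
      (∀ t, Θ.Rel G.structure R t ↔ p (val (t 0)) (val (t 1))) →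
      ∀ q, (Θ.output G.structure).RelMap R q ↔ p (num (q 0)) (num (q 1)) := by
    intro R p hp q
    constructor
    · rintro ⟨t, ht, -, hq⟩
      rw [← hmk.1 (hq 0), ← hmk.1 (hq 1)]
      exact (hp t).1 ht
    · intro h
      -- Both relations depend only on the values, so any tuples with the right values serve as
      -- witnesses.
      choose t ht using fun i => hval (num (q i))
      refine ⟨t, (hp t).2 ?_, fun i => (huniv _).2 ?_, fun i => hmk.2 (ht i)⟩
      · rwa [ht, ht]
      · rw [ht]
        exact hnumlt _
  have hadj := hrel _ (fun p q => ¬ p = q ∧ B p q) hedge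
  have hord := hrel _ (fun p q => p ≤ q) hle
  refine ⟨⟨hdom, ?_⟩, ?_, ?_⟩
  · obtain ⟨t, ht⟩ := hval 0
    exact ⟨t, (huniv t).2 (by rw [ht]; exact Nat.card_pos)⟩
  · simp only [hord, Matrix.cons_val_zero, Matrix.cons_val_one]
    exact
      { refl := fun _ => le_rfl
        trans := fun _ _ _ => le_trans
        antisymm := fun _ _ h h' => hnum (le_antisymm h h')
        total := fun _ _ => le_total _ _ }
  · have hpos : ∀ v, ∃ a, (num a : ℕ) = π v := by
      intro v
      obtain ⟨t, ht⟩ := hval ⟨π v, (hlt v trivial).trans (Nat.lt_succ_self _)⟩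
      let a : Θ.Carrier G.structure :=
        ⟨Quot.mk _ t, t, (huniv t).2 (by rw [ht]; exact hlt v trivial), rfl⟩
      exact ⟨a, congrArg Fin.val (((hmk (t := t) (a := a)).1 rfl).symm.trans ht)⟩
    choose e he using hpos
    have hbij : Function.Bijective e := by
      constructor
      · intro u v h
        exact hinj u v trivial trivial (by rw [← he u, ← he v, h])
      · intro a
        obtain ⟨v, -, hv⟩ := exists_eq_of_injective_of_lt (M := fun _ => True) hinj
          (by rwa [hcard]) (by rw [hcard]; exact hnumlt a)
        exact ⟨v, hnum (Fin.ext ((he v).trans hv))⟩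
    let := Θ.output G.structure
    let : Language.graph.Structure (Θ.Carrier G.structure) :=
      Language.LHom.reduct (L' := WithOrder Language.graph) Language.LHom.sumInl _
    let := G.structure
    refine ⟨⟨(Equiv.ofBijective e hbij).symm, fun f => isEmptyElim f, ?_⟩⟩
    rintro _ ⟨⟩ q
    have hq : ∀ i, (num (q i) : ℕ) = π ((Equiv.ofBijective e hbij).symm (q i)) := by
      intro i
      rw [← he]
      congr 2
      exact ((Equiv.ofBijective e hbij).apply_symm_apply (q i)).symm
    refine Iff.trans ?_ (hadj q).symm
    show G.Adj ((Equiv.ofBijective e hbij).symm (q 0)) ((Equiv.ofBijective e hbij).symm (q 1)) ↔ _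
    rw [hB, Fin.ext_iff, hq, hq]
    constructor
    · exact fun h => ⟨fun h' => h.ne (hinj _ _ trivial trivial h'), _, _, trivial, trivial, rfl,
        rfl, .inr h⟩
    · rintro ⟨hne, u, v, -, -, hu, hv, huv⟩
      rw [← hinj _ _ trivial trivial hu, ← hinj _ _ trivial trivial hv]
      refine huv.resolve_left fun h => hne ?_
      rw [← hu, ← hv, h]

/-- A transduction to ordered graphs whose universe consists of elements of the number sort. -/
abbrev numTransduction (univ : Formula Language.graph (Fin 0) (Fin 1) [])
    (equiv : Formula Language.graph (Fin 0 ⊕ Fin 0) (Fin 1 ⊕ Fin 1) [])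
    (edge le : Formula Language.graph (Fin 2 × Fin 0) (Fin 2 × Fin 1) []) :
    Transduction Language.graph (WithOrder Language.graph) where
  k := 0
  l := 1
  dom := .neg .falsum
  univ := univ
  equiv := equiv
  rel := fun {_} R => match R with
    | Sum.inl .adj => edge
    | Sum.inr .le => le

theorem admitsCanonization_permutationGraphs :
    AdmitsCanonization permutationGraphs.toStructureClass := by
  have hfp : ¬ False := id
  -- The number sort ends at |V|; being below some number singles out the |V| numbers from 0 to |V|
  -- - 1.
  obtain ⟨univ, -, huniv⟩ : Definable False (fun _ _ _ n _ => ∃ q, n 0 < q :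
      Query (Fin 0) (Fin 1) [] fun _ => Prop) := .exNum hfp (.numLT hfp _ _)
  obtain ⟨equiv, -, hequiv⟩ : Definable False (fun _ _ _ n _ => n (.inl 0) = n (.inr 0) :
      Query (Fin 0 ⊕ Fin 0) (Fin 1 ⊕ Fin 1) [] fun _ => Prop) := .numEq hfp _ _
  obtain ⟨le, -, hle⟩ : Definable False (fun _ _ _ n _ => n (0, 0) ≤ n (1, 0) :
      Query (Fin 2 × Fin 0) (Fin 2 × Fin 1) [] fun _ => Prop) := .numLE hfp _ _
  -- At the index |V| the class is the whole vertex set, so `v` is immaterial. The diagonal of the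
  -- code marks vertices and is removed.
  obtain ⟨edge, -, hedge⟩ : Definable False (fun U G _ n _ => ¬ n (0, 0) = n (1, 0) ∧
      ∃ m : Num U, (m : ℕ) = Nat.card U ∧ ∃ v, canonCode G m v (n (0, 0)) (n (1, 0)) :
      Query (Fin 2 × Fin 0) (Fin 2 × Fin 1) [] fun _ => Prop) :=
    .and (.not (.numEq hfp _ _)) (.exNum hfp (.and (.numMax hfp _) (.ex (.canonCode hfp _ _ _ _))))
  refine ⟨numTransduction univ equiv edge le, fun V _ _ S hS => ?_⟩
  obtain ⟨G, ⟨lt₁, lt₂, hG⟩, rfl⟩ := hS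
  obtain ⟨hcode, hcongr⟩ := isCodeOf_canonCode hG (Nat.card V) le_rfl
  rw [Nat.sub_self] at hcode hcongr
  obtain ⟨v₀⟩ := ‹Nonempty V›
  have : Nonempty V := ⟨v₀⟩
  refine canonizes_of_isCodeOf (hcode v₀) (fun h => h) (fun t => t.2 0)
    (fun p => ⟨(Fin.elim0, fun _ => p), rfl⟩) (fun t t' => hequiv _ _ _ _ _) (fun t => ?_)
    (fun t => ?_) (fun t => hle _ _ _ _ _)
  · refine (huniv _ _ _ _ _).trans ?_
    have hp := (t.2 0).2
    constructor
    · rintro ⟨q, hq⟩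
      have := q.2
      have := Fin.lt_def.1 hq
      omega
    · intro h
      exact ⟨⟨Nat.card V, Nat.lt_succ_self _⟩, Fin.lt_def.2 h⟩
  · refine (hedge _ _ _ _ _).trans ?_
    refine and_congr_right fun _ => ⟨?_, fun h => ⟨⟨_, Nat.lt_succ_self _⟩, rfl, v₀, h⟩⟩
    rintro ⟨m, hm, v, h⟩
    rw [hm] at h
    rwa [hcongr v₀ v trivial]

end FPC

/-! ### Canonization and definable orders -/

theorem mainTheorem6 :
    FPC.AdmitsCanonization FPC.permutationGraphs.toStructureClass ∧
    ∃ φ₁ φ₂ : FPC.Formula FirstOrder.Language.graph (Fin 1 ⊕ Fin 2) (Fin 0) [],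
      φ₁.IsFP ∧ φ₂.IsFP ∧
      (∀ (V : Type) [Finite V] [Nonempty V] (G : SimpleGraph V),
        FPC.primePermutationGraphs V G →
          (∀ w v v' : V,
            (φ₁.Sat G.structure (Sum.elim ![w] ![v, v']) ![] FPC.RelAssignment.nil ↔
              FPC.reconstruct₁ G w v v') ∧
            (φ₂.Sat G.structure (Sum.elim ![w] ![v, v']) ![] FPC.RelAssignment.nil ↔
              FPC.reconstruct₂ G w v v')) ∧
          (∀ lt₁ lt₂ : V → V → Prop, FPC.IsRealizer G lt₁ lt₂ →
            ∀ w : V, (∀ v, v ≠ w → lt₁ w v) →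
              FPC.reconstruct₁ G w = lt₁ ∧ FPC.reconstruct₂ G w = lt₂)) ∧
      (φ₁.or (FPC.Formula.eq (Sum.inr 0) (Sum.inr 1))).DefinesOrders
        FPC.primePermutationGraphs := by
  refine ⟨FPC.admitsCanonization_permutationGraphs, ?_⟩
  have hM : FPC.Definable₁ True (fun _ _ _ _ _ _ => True :
      FPC.Query (Fin 1 ⊕ Fin 2) (Fin 0) [] fun U => U → Prop) := ⟨fun _ _ _ _ => .verum⟩
  have hs : FPC.Definable₂ True (fun _ _ _ _ _ => Eq :
      FPC.Query (Fin 1 ⊕ Fin 2) (Fin 0) [] fun U => U → U → Prop) :=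
    ⟨fun _ _ _ a b => .eq a b⟩
  -- With the whole vertex set as class and equality as partition, `Rec` is the reconstruction on
  -- the graph itself.
  obtain ⟨φ₁, hφ₁, h₁⟩ := FPC.Definable.rec_true hM hs (.inl 0) (.inr 0) (.inr 1)
  obtain ⟨φ₂, hφ₂, h₂⟩ := FPC.Definable.rec_false hM hs (.inl 0) (.inr 0) (.inr 1)
  have hsat₁ : ∀ (V : Type) [Finite V] [Nonempty V] (G : SimpleGraph V) (w v v' : V)
      (n : Fin 0 → FPC.Num V),
      φ₁.Sat G.structure (Sum.elim ![w] ![v, v']) n FPC.RelAssignment.nil ↔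
        FPC.reconstruct₁ G w v v' := by
    intro V _ _ G w v v' n
    rw [FPC.reconstruct₁_iff]
    exact h₁ V G _ _ _
  refine ⟨φ₁, φ₂, hφ₁ trivial, hφ₂ trivial, fun V _ _ G hG => ⟨fun w v v' => ⟨hsat₁ .., ?_⟩,
    fun lt₁ lt₂ h w hw => FPC.reconstruct_eq hG.1 h hw⟩, ?_⟩
  · rw [FPC.reconstruct₂_iff]
    exact h₂ V G _ _ _
  · rintro V _ _ G ⟨hG, lt₁, lt₂, h⟩
    obtain ⟨u⟩ := ‹Nonempty V›
    have : Nonempty V := ⟨u⟩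
    -- The parameter is the first element of a realizer, so the defined relation is the reflexive
    -- closure of `lt₁`.
    obtain ⟨w, -, hw⟩ := h.exists_first (M := fun _ => True) (u := u) trivial
    refine ⟨(![w], Fin.elim0), ?_⟩
    have hlt := h.1
    have hor : ∀ y y', (φ₁.or (FPC.Formula.eq (Sum.inr 0) (Sum.inr 1))).Sat G.structure
        (Sum.elim ![w] ![y, y']) Fin.elim0 FPC.RelAssignment.nil ↔ lt₁ y y' ∨ y = y' := by
      intro y y'
      rw [← (FPC.reconstruct_eq hG h fun v hv => hw trivial hv).1, ← hsat₁ V G w y y' Fin.elim0]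
      simp only [FPC.Formula.or, FPC.Formula.Sat]
      exact (or_iff_not_and_not (a := φ₁.Sat G.structure (Sum.elim ![w] ![y, y']) Fin.elim0
        FPC.RelAssignment.nil) (b := y = y')).symm
    simp only [hor]
    exact
      { refl := fun _ => .inr rfl
        trans := by
          rintro a b c (hab | rfl) (hbc | rfl)
          · exact .inl (trans_of lt₁ hab hbc)
          · exact .inl hab
          · exact .inl hbc
          · exact .inr rfl
        antisymm := by
          rintro a b (hab | rfl) (hba | hba)
          · exact absurd hba (h.asymm₁ hab)
          · exact hba.symm
          · rfl
          · rfl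
        total := by
          intro a b
          rcases trichotomous_of lt₁ a b with hab | rfl | hab
          · exact .inl (.inl hab)
          · exact .inl (.inr rfl)
          · exact .inr (.inl hab) }
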